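/- **Theorem (bounds on the Wigner hierarchy).** *Setting.* Let $\Phi:\mathbf R^d\to\mathbf R$ be even with $\Phi(x)=\int_{\mathbf R^d}\widehat\Phi(h)e^{ih\cdot x}\,dh$, $\widehat\Phi\in L^1(\mathbf R^d)$. For $\beta>0$, $t\in\mathbf R$ put $$C_\Phi^\beta(t)=\int_{\mathbf R^d}|h||\widehat\Phi(h)|e^{2\beta|h|(1+|t|)}\,dh .$$ A $j$-particle phase-space distribution is a tempered distribution $f$ on $(\mathbf R^d\times\mathbf R^d)^j$ whose symplectic Fourier transform $$\widetilde f(\xi;\eta)=\int e^{i(x\cdot\xi-v\cdot\eta)}f(x;v)\,dx\,dv,\qquad \xi=(\xi_1,\dots,\xi_j),\ \eta=(\eta_1,\dots,\eta_j)\in(\mathbf R^d)^j,$$ is a bounded continuous function (for instance an integrable function, or the Wigner function of a trace-class operator). Set, with values in $[0,\infty]$, $$\|f\|_\rho=\sup_{\xi,\eta}|\widetilde f(\xi;\eta)|\,e^{\rho\sum_{i=1}^j(|\xi_i|+|\eta_i|)},\qquad \|\underline f\|_{\alpha,\beta}=\sum_{j\ge1}e^{-\alpha j}\|f_j\|_\beta\quad\text{for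 }\underline f=\{f_j\}_{j\ge1}.$$ For $\hbar>0$ and $N\ge1$ the $N$-body Wigner hierarchy is $$\partial_tf_j+\sum_{i=1}^jv_i\cdot\nabla_{x_i}f_j=\frac1NT_jf_j+\frac{N-j}NC_{j+1}f_{j+1}\quad(1\le j\le N),\qquad f_j=0\quad(j>N),$$ where, $h^r\in(\mathbf R^d)^j$ having $r$-th entry $h$ and all other entries $0$, $$\widetilde{T_jf_j}(\xi;\eta)=\tfrac12\sum_{1\le l\ne r\le j}\int\widehat\Phi(h)\frac{2\sin(\frac\hbar2(\eta_r-\eta_l)\cdot h)}\hbar\,\widetilde{f_j}(\xi+h^r-h^l;\eta)\,dh,$$ $$\widetilde{C_{j+1}f_{j+1}}(\xi;\eta)=\sum_{r=1}^j\int\widehat\Phi(h)\frac{2\sin(\frac\hbar2\eta_r\cdot h)}\hbar\,\widetilde{f_{j+1}}(\xi+h^r,-h;\eta,0)\,dh .$$ A solution is a family $\underline f(t)=\{f_j(t)\}_{j\ge1}$, $t\in\mathbf R$, of sequences of phase-space distributions such that each $\widetilde{f_j}(t,\xi;\eta)$ is continuous in $(t,\xi,\eta)$, bounded uniformly in $(\xi,\eta)$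 for $t$ in bounded sets, and satisfies the Fourier transformed equations, the transport operator $\partial_t+\sum_i\xi_i\cdot\nabla_{\eta_i}$ being understood as the derivative along its characteristics. Write $T^N\underline f=\{\frac1NT_jf_j\}_j$, $C^N\underline f=\{\frac{N-j}NC_{j+1}f_{j+1}\}_j$, and $S(t)$ for the free transport group, $\widetilde{S_j(t)f_j}(\xi;\eta)=\widetilde{f_j}(\xi;\eta-t\xi)$. *Statement.* Let $\alpha>0$ and $0<\beta<\beta'$, and assume $C_\Phi^{\beta'}\big(\tfrac{\beta'-\beta}{\beta'}\big)<\infty$. There is exactly one $\beta_0$ with $$\beta<\beta_0\le\beta',\qquad 2(1+\tau)\,\tau\,C_\Phi^{\beta'}(\tau)\,e^\alpha=\beta'-\beta_0,\quad\text{where }\tau=\tfrac{\beta_0-\beta}{\beta_0}.$$ Put $T=T[\alpha,\beta,\beta',\Phi]:=\frac{\beta_0-\beta}{\beta_0}>0$. Then for all $\hbar>0$, all $N\ge1$ and every one-particle phase-space distribution $f^{in}$ with $\|f^{in}\|_{\beta'}<\infty$ and $\alpha>\log\|f^{in}\|_\beta$ the following holds. With the factorized data $f^{in}_j=(f^{in})^{\otimes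 j}$ for $1\le j\le N$, $f^{in}_j=0$ for $j>N$, the $N$-body Wigner hierarchy has exactly one solution $\underline f^N$ with $\underline f^N(0)=\underline f^{in}=\{f^{in}_j\}_{j\ge1}$, and for all $|t|<T$ $$\|\underline f^N(t)\|_{\alpha,\beta}\le\frac{\|\underline f^{in}\|_{\alpha,\beta'}}{1-\frac{|t|}T}.$$ Moreover $\underline f^N(t)$ is the sum of its Dyson expansion: with $u_0(t)=S(t)\underline f^{in}$ and $u_{n+1}(t)=\int_0^tS(t-s)(T^N+C^N)u_n(s)\,ds$, for all $K\ge0$ and $|t|<T$ $$\Big\|\underline f^N(t)-\sum_{n=0}^Ku_n(t)\Big\|_{\alpha,\beta}\le\frac{(|t|/T)^{K+1}}{1-\frac{|t|}T}\,\|\underline f^{in}\|_{\alpha,\beta'} .$$ Here $T$ depends neither on $N$ nor on $\hbar$. -/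

import Mathlib

open MeasureTheory Filter Topology
open scoped ENNReal SchwartzMap FourierTransform

noncomputable section

namespace WignerHierarchy

/-- The one-particle configuration (or velocity, or frequency) space `ℝ^d`. -/
abbrev Space (d : ℕ) := EuclideanSpace ℝ (Fin d)

/-- The phase space `(ℝ^d)^j × (ℝ^d)^j` of `j` particles with its Euclidean structure. The point
`z = (x₁,…,x_j; v₁,…,v_j)` has the entries `z (0, i) = xᵢ` and `z (1, i) = vᵢ`. -/
abbrev PhaseSpace (d j : ℕ) := PiLp 2 (fun _ : Fin 2 × Fin j => Space d)

/-- Functions of the Fourier variables `(ξ₁,…,ξ_j; η₁,…,η_j)`. -/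
abbrev FourierFun (d j : ℕ) := (Fin j → Space d) → (Fin j → Space d) → ℂ

/-- A `j`-particle phase-space distribution: a tempered distribution `f` on `(ℝ^d × ℝ^d)^j` whose
symplectic Fourier transform `f̃(ξ;η) = ∫ e^{i(x·ξ - v·η)} f(x;v) dx dv` is a bounded continuous
function. Every integrable function and the Wigner function of every trace-class operator are of
this kind. The field `ft` is `f̃`; it is determined by `distr`, and determines it.

In terms of Mathlib's Fourier transform `𝓕 f(a,b) = ∫ e^{-2πi(x·a + v·b)} f(x;v) dx dv` one has
`𝓕 f (a,b) = f̃(-2πa; 2πb)`; for distributions `⟨𝓕 f, ψ⟩ = ⟨f, 𝓕 ψ⟩`. -/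
@[ext] structure WignerDistribution (d j : ℕ) where
  distr : 𝓢'(PhaseSpace d j, ℂ)
  ft : FourierFun d j
  ft_continuous : Continuous fun p : (Fin j → Space d) × (Fin j → Space d) => ft p.1 p.2
  ft_bounded : ∃ M : ℝ, ∀ ξ η, ‖ft ξ η‖ ≤ M
  fourier_eq : ∀ ψ : 𝓢(PhaseSpace d j, ℂ),
    distr (𝓕 ψ) = ∫ w : PhaseSpace d j,
      ψ w * ft (fun i => -(2 * Real.pi) • w (0, i)) (fun i => (2 * Real.pi) • w (1, i))

/-! ### Norms -/

/-- `sup_{ξ,η} |f̃(ξ;η)| e^{ρ ∑ᵢ (|ξᵢ| + |ηᵢ|)}`, with values in `[0,∞]`. -/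
def fourierNorm {d j : ℕ} (ρ : ℝ) (φ : FourierFun d j) : ℝ≥0∞ :=
  ⨆ (ξ : Fin j → Space d) (η : Fin j → Space d),
    ENNReal.ofReal (‖φ ξ η‖ * Real.exp (ρ * ∑ i, (‖ξ i‖ + ‖η i‖)))

/-- The norm `‖f‖_ρ` of a phase-space distribution. -/
def WignerDistribution.norm {d j : ℕ} (ρ : ℝ) (f : WignerDistribution d j) : ℝ≥0∞ :=
  fourierNorm ρ f.ft

/-- The norm `‖f‖_{α,β} = ∑_{j ≥ 1} e^{-αj} ‖f_j‖_β` of a sequence, in Fourier variables. The sum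
starts at `j = 1`: the entry with index `0` plays no role. -/
def fourierSeqNorm {d : ℕ} (α β : ℝ) (u : ∀ j : ℕ, FourierFun d j) : ℝ≥0∞ :=
  ∑' k : ℕ, ENNReal.ofReal (Real.exp (-α * ((k + 1 : ℕ) : ℝ))) * fourierNorm β (u (k + 1))

/-- The norm `‖f‖_{α,β}` of a sequence `(f_j)_{j ≥ 1}` of phase-space distributions. -/
def seqNorm {d : ℕ} (α β : ℝ) (f : ∀ j : ℕ, WignerDistribution d j) : ℝ≥0∞ :=
  fourierSeqNorm α β fun j => (f j).ft

/-! ### The potential -/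

/-- `Φ(x) = ∫ Φ̂(h) e^{i h·x} dh` with `Φ̂` integrable, i.e. `Φ̂` is the Fourier transform of `Φ` with
the normalization `Φ̂(h) = (2π)^{-d} ∫ Φ(x) e^{-i h·x} dx`. -/
def IsFourierTransform {d : ℕ} (Φ : Space d → ℝ) (Φhat : Space d → ℂ) : Prop :=
  Integrable Φhat ∧
    ∀ x, (Φ x : ℂ) = ∫ h, Φhat h * Complex.exp (Complex.I * ((inner ℝ h x : ℝ) : ℂ))

/-- The integrand `|h| |Φ̂(h)| e^{2β|h|(1+|t|)}` of `C_Φ^β(t)`. -/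
def potentialWeight {d : ℕ} (Φhat : Space d → ℂ) (β t : ℝ) (h : Space d) : ℝ :=
  ‖h‖ * ‖Φhat h‖ * Real.exp (2 * β * ‖h‖ * (1 + |t|))

/-- `C_Φ^β(t) = ∫ |h| |Φ̂(h)| e^{2β|h|(1+|t|)} dh`. -/
def potentialConst {d : ℕ} (Φhat : Space d → ℂ) (β t : ℝ) : ℝ :=
  ∫ h, potentialWeight Φhat β t h

/-- The relation that determines `β₀ = β₀[α,β,β',Φ]`: with `τ = (β₀ - β)/β₀`,
`β < β₀ ≤ β'` and `2(1+τ) τ C_Φ^{β'}(τ) e^α = β' - β₀`. -/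
def IsBetaZero {d : ℕ} (Φhat : Space d → ℂ) (α β β' β₀ : ℝ) : Prop :=
  β < β₀ ∧ β₀ ≤ β' ∧
    2 * (1 + (β₀ - β) / β₀) * ((β₀ - β) / β₀) * potentialConst Φhat β' ((β₀ - β) / β₀)
      * Real.exp α = β' - β₀

/-! ### The operators of the Wigner hierarchy, in Fourier variables -/

/-- `T_j`:
`½ ∑_{l ≠ r} ∫ Φ̂(h) (2 sin(ħ/2 (η_r - η_l)·h)/ħ) φ(ξ + h^r - h^l; η) dh`, where `h^r` has `h` in
slot `r` and `0` elsewhere. -/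
def opT {d : ℕ} (Φhat : Space d → ℂ) (ħ : ℝ) (j : ℕ) (φ : FourierFun d j) : FourierFun d j :=
  fun ξ η => (1 / 2 : ℂ) * ∑ l : Fin j, ∑ r ∈ Finset.univ.filter (fun r => r ≠ l),
    ∫ h : Space d, Φhat h * ((2 * Real.sin (ħ / 2 * inner ℝ (η r - η l) h) / ħ : ℝ) : ℂ)
      * φ (ξ + Pi.single r h - Pi.single l h) η

/-- `C_{j+1}`:
`∑_r ∫ Φ̂(h) (2 sin(ħ/2 η_r·h)/ħ) φ(ξ + h^r, -h; η, 0) dh`. -/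
def opC {d : ℕ} (Φhat : Space d → ℂ) (ħ : ℝ) (j : ℕ) (φ : FourierFun d (j + 1)) :
    FourierFun d j :=
  fun ξ η => ∑ r : Fin j,
    ∫ h : Space d, Φhat h * ((2 * Real.sin (ħ / 2 * inner ℝ (η r) h) / ħ : ℝ) : ℂ)
      * φ (Fin.snoc (α := fun _ => Space d) (ξ + Pi.single r h) (-h))
          (Fin.snoc (α := fun _ => Space d) η 0)

/-- The right-hand side `(1/N) T_j f_j + ((N-j)/N) C_{j+1} f_{j+1}` of the `j`-th equation. -/
def interaction {d : ℕ} (Φhat : Space d → ℂ) (ħ : ℝ) (N : ℕ) (u : ∀ j : ℕ, FourierFun d j)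
    (j : ℕ) : FourierFun d j :=
  fun ξ η => (1 / (N : ℂ)) * opT Φhat ħ j (u j) ξ η
    + (((N : ℂ) - (j : ℂ)) / (N : ℂ)) * opC Φhat ħ j (u (j + 1)) ξ η

/-- The free transport group `S_j(t)f(x;v) = f(x - tv; v)`, in Fourier variables
`φ(ξ; η - tξ)`. -/
def transport {d j : ℕ} (t : ℝ) (φ : FourierFun d j) : FourierFun d j :=
  fun ξ η => φ ξ (η - t • ξ)

/-- Factorized data in Fourier variables: `f^{in}_j = (f^{in})^{⊗ j}`, with Fourier transform
`∏ᵢ f̃^{in}(ξᵢ;ηᵢ)`, for `1 ≤ j ≤ N`, and `0` otherwise. -/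
def factorizedData {d : ℕ} (N : ℕ) (f : WignerDistribution d 1) (j : ℕ) : FourierFun d j :=
  fun ξ η => if 1 ≤ j ∧ j ≤ N then ∏ i, f.ft (fun _ => ξ i) (fun _ => η i) else 0

/-- `f = (f_j)` is a (global in time) solution of the `N`-body Wigner hierarchy
`∂_t f_j + ∑ᵢ vᵢ·∇_{xᵢ} f_j = (1/N) T_j f_j + ((N-j)/N) C_{j+1} f_{j+1}`, `1 ≤ j ≤ N`,
`f_j = 0` for `j > N`, with factorized initial data. In Fourier variables the left-hand side is
`(∂_t + ∑ᵢ ξᵢ·∇_{ηᵢ}) f̃_j`, the derivative along the characteristic `s ↦ (s, ξ, η + (s-t)ξ)`.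
The entry with index `0` is no unknown of the hierarchy and is set to `0`. -/
structure IsSolution {d : ℕ} (Φhat : Space d → ℂ) (ħ : ℝ) (N : ℕ) (fin : WignerDistribution d 1)
    (f : ℝ → ∀ j : ℕ, WignerDistribution d j) : Prop where
  continuous : ∀ j, Continuous fun p : ℝ × (Fin j → Space d) × (Fin j → Space d) =>
    (f p.1 j).ft p.2.1 p.2.2
  locally_bounded : ∀ (j : ℕ) (τ : ℝ), ∃ M : ℝ, ∀ t, |t| ≤ τ → ∀ ξ η, ‖(f t j).ft ξ η‖ ≤ M
  vanish : ∀ t j, ¬ (1 ≤ j ∧ j ≤ N) → (f t j).ft = 0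
  initial : ∀ j, (f 0 j).ft = factorizedData N fin j
  equation : ∀ j, 1 ≤ j → j ≤ N → ∀ t ξ η,
    HasDerivAt (fun s : ℝ => (f s j).ft ξ (η + (s - t) • ξ))
      (interaction Φhat ħ N (fun k => (f t k).ft) j ξ η) t

/-! ### The Dyson expansion -/

/-- The terms of the Dyson expansion, in Fourier variables: `u₀(t) = S(t) f^{in}` and
`u_{n+1}(t) = ∫₀ᵗ S(t-s)(T^N + C^N) u_n(s) ds`, that is
`u_n(t) = ∫₀ᵗ dt_n ⋯ ∫₀^{t₂} dt₁ S(t-t_n)(T^N+C^N)S(t_n-t_{n-1}) ⋯ (T^N+C^N)S(t₁) f^{in}`. -/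
def dysonTerm {d : ℕ} (Φhat : Space d → ℂ) (ħ : ℝ) (N : ℕ) (fin : WignerDistribution d 1) :
    ℕ → ℝ → ∀ j : ℕ, FourierFun d j
  | 0, t, j => transport t (factorizedData N fin j)
  | n + 1, t, j => fun ξ η =>
      ∫ s in (0 : ℝ)..t,
        transport (t - s) (interaction Φhat ħ N (dysonTerm Φhat ħ N fin n s) j) ξ η

/-- The partial sum `∑_{n ≤ K} u_n(t)` of the Dyson expansion. -/
def dysonSum {d : ℕ} (Φhat : Space d → ℂ) (ħ : ℝ) (N : ℕ) (fin : WignerDistribution d 1)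
    (K : ℕ) (t : ℝ) (j : ℕ) : FourierFun d j :=
  fun ξ η => ∑ n ∈ Finset.range (K + 1), dysonTerm Φhat ħ N fin n t j ξ η

end WignerHierarchy

end

/-!
The proof rests on the Dyson expansion `∑ₙ uₙ`, estimated twice.

*Global existence and uniqueness.* Since `|2 sin(x)/ħ| ≤ 2/ħ` and `Φ̂` is integrable, the
interaction `T^N + C^N` is bounded on bounded sequences truncated at `N`, with a norm `B` that
depends on `ħ` and `N`. Hence `uₙ(t)` is at most `M (B|t|)ⁿ/n!` in the supremum norm, the series
converges locally uniformly for all times, and its sum solves the mild form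
`U(t) = S(t) f^{in} + ∫₀ᵗ S(t-s) (T^N + C^N) U(s) ds`, which is equivalent to the hierarchy by the
fundamental theorem of calculus along characteristics. Conversely the remainder of any mild
solution after `n` terms is the `n`-fold iterate of the Duhamel operator on that solution, so it is
at most `M (B|t|)ⁿ/n!`. Thus every solution is the sum of the Dyson expansion, which gives
uniqueness (`IsMildSolution.hasSum_dysonTerm`, `existsUnique_isSolution`).

*Bounds uniform in `ħ` and `N`.* With `|2 sin(ħx/2)/ħ| ≤ |x|` instead, the interaction costs a
factor `∑ᵢ (|ξᵢ| + |ηᵢ|)`, which is paid by lowering the exponential rate `ρ` of the norm, as in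
the abstract Cauchy–Kovalevskaya theorem. The terms are read along the free flow, as
`uₙ(t)(ξ; η + tξ)`, so that transport costs nothing until the end, where it turns the rate
`β(1 + τ)`, `τ = (β₀ - β)/β₀`, into `β`. Distributing the loss `β' - β(1 + τ)` equally over the `n`
interactions and using `nⁿ ≤ eⁿ n!` bounds the `n`-th term by
`(2 e^α C_Φ^{β'}(τ) |t| / (β' - β(1 + τ)))ⁿ` times the norm of the data
(`norm_dysonTerm_le_exp`, `fourierNorm_dysonTerm_le`, `tsum_cascade_le`). As
`β(1 + τ) = β₀(1 - τ²) < β₀`, the relation for `β₀` makes this at most `(|t|/T)ⁿ`, and the two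
estimates of the theorem are sums of a geometric series (`fourierSeqNorm_sub_dyson_le`).

The number `β₀` is unique because the two sides of its relation are monotone in opposite
directions, and exists by the intermediate value theorem (`existsUnique_isBetaZero`).
-/

namespace WignerHierarchy

variable {d : ℕ}

/-! ### Distributions with prescribed Fourier transform -/

/-- A `WignerDistribution` is determined by its symplectic Fourier transform, because the Fourier
transform is onto on Schwartz functions. -/
theorem WignerDistribution.ext_ft {j : ℕ} {f g : WignerDistribution d j} (h : f.ft = g.ft) :
    f = g := by
  refine WignerDistribution.ext ?_ h
  ext ψ
  have hf := f.fourier_eq (𝓕⁻ ψ)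
  have hg := g.fourier_eq (𝓕⁻ ψ)
  rw [FourierTransform.fourier_fourierInv_eq] at hf hg
  rw [hf, hg, h]

/-- Every bounded continuous function is the symplectic Fourier transform of a tempered
distribution. -/
theorem WignerDistribution.exists_ft_eq {j : ℕ} (φ : FourierFun d j)
    (hc : Continuous fun p : (Fin j → Space d) × (Fin j → Space d) => φ p.1 p.2)
    (hb : ∃ M : ℝ, ∀ ξ η, ‖φ ξ η‖ ≤ M) :
    ∃ f : WignerDistribution d j, f.ft = φ := by
  let g : PhaseSpace d j → ℂ := fun w =>
    φ (fun i => -(2 * Real.pi) • w (0, i)) (fun i => (2 * Real.pi) • w (1, i))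
  have hg : Continuous g := hc.comp (f := fun w : PhaseSpace d j =>
    ((fun i => -(2 * Real.pi) • w (0, i), fun i => (2 * Real.pi) • w (1, i)) :
      (Fin j → Space d) × (Fin j → Space d))) (by fun_prop)
  have hmem : MemLp g ∞ volume := by
    obtain ⟨M, hM⟩ := hb
    exact memLp_top_of_bound hg.aestronglyMeasurable M (.of_forall fun w => hM _ _)
  let D : 𝓢'(PhaseSpace d j, ℂ) :=
    𝓕⁻ (Lp.toTemperedDistribution (hmem.toLp g))
  refine ⟨⟨D, φ, hc, hb, fun ψ => ?_⟩, rfl⟩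
  have h1 : D (𝓕 ψ) = Lp.toTemperedDistribution (hmem.toLp g) ψ := by
    simp [D]
  rw [h1, Lp.toTemperedDistribution_apply]
  refine integral_congr_ae ?_
  filter_upwards [hmem.coeFn_toLp] with w hw
  rw [hw, smul_eq_mul]

/-! ### The interaction on bounded functions -/

theorem abs_sin_kernel_le {ħ : ℝ} (hħ : 0 < ħ) (x : ℝ) :
    |2 * Real.sin x / ħ| ≤ 2 / ħ := by
  rw [abs_div, abs_mul, abs_of_pos hħ, abs_two]
  gcongr
  linarith [Real.abs_sin_le_one x]

theorem abs_sin_kernel_le_norm {ħ : ℝ} (hħ : 0 < ħ) (a h : Space d) :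
    |2 * Real.sin (ħ / 2 * inner ℝ a h) / ħ| ≤ ‖a‖ * ‖h‖ := by
  have h1 : |Real.sin (ħ / 2 * inner ℝ a h)| ≤ ħ / 2 * (‖a‖ * ‖h‖) :=
    Real.abs_sin_le_abs.trans (by
      rw [abs_mul, abs_of_pos (by positivity : 0 < ħ / 2)]
      gcongr
      exact abs_real_inner_le_norm a h)
  rw [abs_div, abs_mul, abs_of_pos hħ, abs_two, div_le_iff₀ hħ]
  linarith

theorem norm_integral_kernel_le {Φhat : Space d → ℂ} (hΦ : Integrable Φhat) {ħ : ℝ} (hħ : 0 < ħ)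
    (a : Space d) {ψ : Space d → ℂ} {M : ℝ} (hψ : ∀ h, ‖ψ h‖ ≤ M) :
    ‖∫ h, Φhat h * ((2 * Real.sin (ħ / 2 * inner ℝ a h) / ħ : ℝ) : ℂ) * ψ h‖ ≤
      2 / ħ * (∫ h, ‖Φhat h‖) * M := by
  have : 2 / ħ * (∫ h, ‖Φhat h‖) * M = ∫ h, ‖Φhat h‖ * (2 / ħ * M) := by
    rw [integral_mul_const]; ring
  rw [this]
  refine norm_integral_le_of_norm_le (hΦ.norm.mul_const _) (.of_forall fun h => ?_)
  rw [norm_mul, norm_mul, Complex.norm_real, Real.norm_eq_abs, mul_assoc]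
  gcongr
  · exact abs_sin_kernel_le hħ _
  · exact hψ h

theorem integrable_kernel {Φhat : Space d → ℂ} (hΦ : Integrable Φhat) {ħ : ℝ} (hħ : 0 < ħ)
    (a : Space d) {ψ : Space d → ℂ} (hc : Continuous ψ) {M : ℝ} (hψ : ∀ h, ‖ψ h‖ ≤ M) :
    Integrable fun h => Φhat h * ((2 * Real.sin (ħ / 2 * inner ℝ a h) / ħ : ℝ) : ℂ) * ψ h := by
  have hk : Continuous fun h : Space d =>
      ((2 * Real.sin (ħ / 2 * inner ℝ a h) / ħ : ℝ) : ℂ) := by fun_prop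
  refine (hΦ.norm.mul_const (2 / ħ * M)).mono'
    ((hΦ.aestronglyMeasurable.mul hk.aestronglyMeasurable).mul hc.aestronglyMeasurable)
    (.of_forall fun h => ?_)
  rw [norm_mul, norm_mul, Complex.norm_real, Real.norm_eq_abs, mul_assoc]
  gcongr
  · exact abs_sin_kernel_le hħ _
  · exact hψ h

theorem continuous_integral_kernel {X : Type*} [TopologicalSpace X] [FirstCountableTopology X]
    {Φhat : Space d → ℂ} (hΦ : Integrable Φhat) {ħ : ℝ} (hħ : 0 < ħ)
    {a : X → Space d} (ha : Continuous a) {ψ : X → Space d → ℂ}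
    (hc : Continuous fun p : X × Space d => ψ p.1 p.2)
    (hψ : ∀ x₀, ∃ M : ℝ, ∀ᶠ x in 𝓝 x₀, ∀ h, ‖ψ x h‖ ≤ M) :
    Continuous fun x =>
      ∫ h, Φhat h * ((2 * Real.sin (ħ / 2 * inner ℝ (a x) h) / ħ : ℝ) : ℂ) * ψ x h := by
  refine continuous_iff_continuousAt.2 fun x₀ => ?_
  obtain ⟨M, hM⟩ := hψ x₀
  have hc1 : ∀ x, Continuous (ψ x) := fun x => hc.comp (by fun_prop : Continuous fun h => (x, h))
  have hc2 : ∀ h, Continuous fun x => ψ x h := fun h =>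
    hc.comp (by fun_prop : Continuous fun x => (x, h))
  refine continuousAt_of_dominated (bound := fun h => ‖Φhat h‖ * (2 / ħ * M)) ?_ ?_
    (hΦ.norm.mul_const _) (.of_forall fun h => ?_)
  · filter_upwards [hM] with x hx
    exact (integrable_kernel hΦ hħ (a x) (hc1 x) hx).aestronglyMeasurable
  · filter_upwards [hM] with x hx
    refine .of_forall fun h => ?_
    rw [norm_mul, norm_mul, Complex.norm_real, Real.norm_eq_abs, mul_assoc]
    gcongr
    · exact abs_sin_kernel_le hħ _
    · exact hx h
  · have := hc2 h
    refine Continuous.continuousAt ?_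
    fun_prop

theorem norm_opT_le {Φhat : Space d → ℂ} (hΦ : Integrable Φhat) {ħ : ℝ} (hħ : 0 < ħ)
    {j : ℕ} {φ : FourierFun d j} {M : ℝ} (hφ : ∀ ξ η, ‖φ ξ η‖ ≤ M) (ξ η : Fin j → Space d) :
    ‖opT Φhat ħ j φ ξ η‖ ≤ j * j * (1 / ħ * (∫ h, ‖Φhat h‖) * M) := by
  have hM : 0 ≤ M := (norm_nonneg _).trans (hφ ξ η)
  have hI : 0 ≤ ∫ h, ‖Φhat h‖ := integral_nonneg fun _ => norm_nonneg _
  have hK : 0 ≤ 2 / ħ * (∫ h, ‖Φhat h‖) * M := by positivity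
  unfold opT
  rw [norm_mul]
  have h2 : ‖(1 / 2 : ℂ)‖ = 1 / 2 := by norm_num
  rw [h2]
  have := calc
    ‖∑ l : Fin j, ∑ r ∈ Finset.univ.filter (fun r => r ≠ l),
        ∫ h : Space d, Φhat h * ((2 * Real.sin (ħ / 2 * inner ℝ (η r - η l) h) / ħ : ℝ) : ℂ)
          * φ (ξ + Pi.single r h - Pi.single l h) η‖
      ≤ ∑ l : Fin j, ∑ r ∈ Finset.univ.filter (fun r => r ≠ l),
          (2 / ħ * (∫ h, ‖Φhat h‖) * M) :=
        norm_sum_le_of_le _ fun l _ => norm_sum_le_of_le _ fun r _ =>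
          norm_integral_kernel_le hΦ hħ _ fun h => hφ _ _
    _ ≤ ∑ l : Fin j, ∑ r : Fin j, (2 / ħ * (∫ h, ‖Φhat h‖) * M) := by
        gcongr
        exact Finset.filter_subset _ _
    _ = j * j * (2 / ħ * (∫ h, ‖Φhat h‖) * M) := by
        simp; ring
  calc _ ≤ 1 / 2 * (j * j * (2 / ħ * (∫ h, ‖Φhat h‖) * M)) := by gcongr
    _ = _ := by ring

theorem norm_opC_le {Φhat : Space d → ℂ} (hΦ : Integrable Φhat) {ħ : ℝ} (hħ : 0 < ħ)
    {j : ℕ} {φ : FourierFun d (j + 1)} {M : ℝ} (hφ : ∀ ξ η, ‖φ ξ η‖ ≤ M)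
    (ξ η : Fin j → Space d) :
    ‖opC Φhat ħ j φ ξ η‖ ≤ j * (2 / ħ * (∫ h, ‖Φhat h‖) * M) := by
  unfold opC
  calc _ ≤ ∑ r : Fin j, (2 / ħ * (∫ h, ‖Φhat h‖) * M) :=
        norm_sum_le_of_le _ fun r _ => norm_integral_kernel_le hΦ hħ _ fun h => hφ _ _
    _ = _ := by simp

/-- The sequence has no entries outside `1 ≤ j ≤ N`. -/
def IsTruncated (N : ℕ) (u : ∀ j : ℕ, FourierFun d j) : Prop :=
  ∀ j, ¬ (1 ≤ j ∧ j ≤ N) → u j = 0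

theorem interaction_eq_zero {Φhat : Space d → ℂ} {ħ : ℝ} {N : ℕ} {u : ∀ j : ℕ, FourierFun d j}
    (hu : IsTruncated N u) : IsTruncated N (interaction Φhat ħ N u) := by
  intro j hj
  ext ξ η
  rcases Nat.eq_zero_or_pos j with rfl | hj0
  · simp [interaction, opT, opC]
  · have h1 : u j = 0 := hu j hj
    have h2 : u (j + 1) = 0 := hu (j + 1) (by omega)
    simp [interaction, opT, opC, h1, h2]

/-- The norm bound of the interaction on bounded sequences truncated at `N`; it uses
`|sin| ≤ 1`, so it is not uniform in `ħ`. -/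
noncomputable def interactionBound (Φhat : Space d → ℂ) (ħ : ℝ) (N : ℕ) : ℝ :=
  N * (3 / ħ * ∫ h, ‖Φhat h‖)

theorem interactionBound_nonneg (Φhat : Space d → ℂ) {ħ : ℝ} (hħ : 0 < ħ) (N : ℕ) :
    0 ≤ interactionBound Φhat ħ N := by
  have hI : 0 ≤ ∫ h, ‖Φhat h‖ := integral_nonneg fun _ => norm_nonneg _
  unfold interactionBound; positivity

theorem norm_interaction_le {Φhat : Space d → ℂ} (hΦ : Integrable Φhat) {ħ : ℝ} (hħ : 0 < ħ)
    {N : ℕ} {u : ∀ j : ℕ, FourierFun d j} (hu : IsTruncated N u) {M : ℝ}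
    (hM : ∀ j ξ η, ‖u j ξ η‖ ≤ M) (j : ℕ) (ξ η : Fin j → Space d) :
    ‖interaction Φhat ħ N u j ξ η‖ ≤ interactionBound Φhat ħ N * M := by
  have hM0 : 0 ≤ M := (norm_nonneg _).trans (hM j ξ η)
  have hI : 0 ≤ ∫ h, ‖Φhat h‖ := integral_nonneg fun _ => norm_nonneg _
  by_cases hj : 1 ≤ j ∧ j ≤ N
  · have hN : (0 : ℝ) < N := by exact_mod_cast hj.1.trans hj.2
    have hjN : (j : ℝ) ≤ N := by exact_mod_cast hj.2
    have e1 : ‖(1 / (N : ℂ))‖ = 1 / N := by simp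
    have e2 : ‖((N : ℂ) - (j : ℂ)) / (N : ℂ)‖ ≤ 1 := by
      rw [norm_div, show (N : ℂ) - (j : ℂ) = ((N - j : ℝ) : ℂ) by push_cast; rfl,
        Complex.norm_real, Complex.norm_natCast, Real.norm_of_nonneg (by linarith),
        div_le_one hN]
      linarith [(Nat.cast_nonneg j : (0 : ℝ) ≤ j)]
    unfold interaction interactionBound
    refine (norm_add_le _ _).trans ?_
    rw [norm_mul, norm_mul, e1]
    calc _ ≤ 1 / N * (N * N * (1 / ħ * (∫ h, ‖Φhat h‖) * M))
          + 1 * (N * (2 / ħ * (∫ h, ‖Φhat h‖) * M)) := by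
          gcongr
          · refine (norm_opT_le hΦ hħ (hM j) ξ η).trans ?_
            gcongr
          · refine (norm_opC_le hΦ hħ (hM (j + 1)) ξ η).trans ?_
            gcongr
      _ = _ := by field_simp; ring
  · rw [interaction_eq_zero hu j hj]
    simpa using mul_nonneg (interactionBound_nonneg Φhat hħ N) hM0

/-- Bounded and continuous in the Fourier variables. -/
def IsRegular {j : ℕ} (φ : FourierFun d j) : Prop :=
  (Continuous fun p : (Fin j → Space d) × (Fin j → Space d) => φ p.1 p.2) ∧
    ∃ M : ℝ, ∀ ξ η, ‖φ ξ η‖ ≤ M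

theorem opT_sub {Φhat : Space d → ℂ} (hΦ : Integrable Φhat) {ħ : ℝ} (hħ : 0 < ħ)
    {j : ℕ} {φ ψ : FourierFun d j} (hφ : IsRegular φ) (hψ : IsRegular ψ)
    (ξ η : Fin j → Space d) :
    opT Φhat ħ j (φ - ψ) ξ η = opT Φhat ħ j φ ξ η - opT Φhat ħ j ψ ξ η := by
  have key : ∀ {χ : FourierFun d j}, IsRegular χ → ∀ l r : Fin j, Integrable fun h =>
      Φhat h * ((2 * Real.sin (ħ / 2 * inner ℝ (η r - η l) h) / ħ : ℝ) : ℂ)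
        * χ (ξ + Pi.single r h - Pi.single l h) η := by
    rintro χ ⟨hc, M, hM⟩ l r
    refine integrable_kernel hΦ hħ _ ?_ fun h => hM _ _
    exact hc.comp (f := fun h => (ξ + Pi.single r h - Pi.single l h, η))
      (by have := continuous_single (A := fun _ : Fin j => Space d) r
          have := continuous_single (A := fun _ : Fin j => Space d) l
          fun_prop)
  simp only [opT, Pi.sub_apply, mul_sub, integral_sub (key hφ _ _) (key hψ _ _),
    Finset.sum_sub_distrib]

theorem opC_sub {Φhat : Space d → ℂ} (hΦ : Integrable Φhat) {ħ : ℝ} (hħ : 0 < ħ)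
    {j : ℕ} {φ ψ : FourierFun d (j + 1)} (hφ : IsRegular φ) (hψ : IsRegular ψ)
    (ξ η : Fin j → Space d) :
    opC Φhat ħ j (φ - ψ) ξ η = opC Φhat ħ j φ ξ η - opC Φhat ħ j ψ ξ η := by
  have key : ∀ {χ : FourierFun d (j + 1)}, IsRegular χ → ∀ r : Fin j, Integrable fun h =>
      Φhat h * ((2 * Real.sin (ħ / 2 * inner ℝ (η r) h) / ħ : ℝ) : ℂ)
        * χ (Fin.snoc (α := fun _ => Space d) (ξ + Pi.single r h) (-h))
          (Fin.snoc (α := fun _ => Space d) η 0) := by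
    rintro χ ⟨hc, M, hM⟩ r
    refine integrable_kernel hΦ hħ _ ?_ fun h => hM _ _
    have h1 : Continuous fun h : Space d => ξ + Pi.single r h := by
      have := continuous_single (A := fun _ : Fin j => Space d) r
      fun_prop
    exact hc.comp ((h1.finSnoc (A := fun _ => Space d) continuous_neg).prodMk continuous_const)
  simp only [opC, Pi.sub_apply, mul_sub, integral_sub (key hφ _) (key hψ _),
    Finset.sum_sub_distrib]

theorem interaction_sub {Φhat : Space d → ℂ} (hΦ : Integrable Φhat) {ħ : ℝ} (hħ : 0 < ħ) {N : ℕ}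
    {u v : ∀ j : ℕ, FourierFun d j} (hu : ∀ j, IsRegular (u j)) (hv : ∀ j, IsRegular (v j))
    (j : ℕ) (ξ η : Fin j → Space d) :
    interaction Φhat ħ N (u - v) j ξ η =
      interaction Φhat ħ N u j ξ η - interaction Φhat ħ N v j ξ η := by
  simp only [interaction, Pi.sub_apply u v, opT_sub hΦ hħ (hu j) (hv j),
    opC_sub hΦ hħ (hu (j + 1)) (hv (j + 1))]
  ring

/-! ### The Duhamel operator -/

/-- The class of time-dependent sequences in which the hierarchy is solved: jointly continuous,
bounded locally uniformly in time, and truncated at `N`. -/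
structure IsAdmissible (N : ℕ) (U : ℝ → ∀ j : ℕ, FourierFun d j) : Prop where
  continuous : ∀ j, Continuous fun p : ℝ × (Fin j → Space d) × (Fin j → Space d) =>
    U p.1 j p.2.1 p.2.2
  bounded : ∀ τ : ℝ, ∃ M : ℝ, ∀ t, |t| ≤ τ → ∀ j ξ η, ‖U t j ξ η‖ ≤ M
  truncated : ∀ t, IsTruncated N (U t)

theorem IsAdmissible.isRegular {N : ℕ} {U : ℝ → ∀ j : ℕ, FourierFun d j} (hU : IsAdmissible N U)
    (t : ℝ) (j : ℕ) : IsRegular (U t j) := by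
  obtain ⟨M, hM⟩ := hU.bounded |t|
  exact ⟨(hU.continuous j).comp (by fun_prop :
    Continuous fun p : (Fin j → Space d) × (Fin j → Space d) => (t, p)), M, hM t le_rfl j⟩

theorem IsAdmissible.sub {N : ℕ} {U V : ℝ → ∀ j : ℕ, FourierFun d j} (hU : IsAdmissible N U)
    (hV : IsAdmissible N V) : IsAdmissible N (U - V) where
  continuous j := (hU.continuous j).sub (hV.continuous j)
  bounded τ := by
    obtain ⟨M, hM⟩ := hU.bounded τ
    obtain ⟨M', hM'⟩ := hV.bounded τ
    exact ⟨M + M', fun t ht j ξ η => norm_sub_le_of_le (hM t ht j ξ η) (hM' t ht j ξ η)⟩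
  truncated t j hj := by simp [hU.truncated t j hj, hV.truncated t j hj]

theorem IsAdmissible.add {N : ℕ} {U V : ℝ → ∀ j : ℕ, FourierFun d j} (hU : IsAdmissible N U)
    (hV : IsAdmissible N V) : IsAdmissible N (U + V) where
  continuous j := (hU.continuous j).add (hV.continuous j)
  bounded τ := by
    obtain ⟨M, hM⟩ := hU.bounded τ
    obtain ⟨M', hM'⟩ := hV.bounded τ
    exact ⟨M + M', fun t ht j ξ η => norm_add_le_of_le (hM t ht j ξ η) (hM' t ht j ξ η)⟩
  truncated t j hj := by simp [hU.truncated t j hj, hV.truncated t j hj]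

theorem IsAdmissible.zero (N : ℕ) : IsAdmissible N (0 : ℝ → ∀ j : ℕ, FourierFun d j) where
  continuous _ := continuous_const
  bounded _ := ⟨0, fun t _ j ξ η => by simp⟩
  truncated _ _ _ := rfl

theorem IsAdmissible.interaction {Φhat : Space d → ℂ} (hΦ : Integrable Φhat) {ħ : ℝ} (hħ : 0 < ħ)
    {N : ℕ} {U : ℝ → ∀ j : ℕ, FourierFun d j} (hU : IsAdmissible N U) :
    IsAdmissible N (fun t => interaction Φhat ħ N (U t)) where
  continuous j := by
    have hloc : ∀ t₀ : ℝ, ∃ M : ℝ, ∀ᶠ t in 𝓝 t₀, ∀ j ξ η, ‖U t j ξ η‖ ≤ M := by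
      intro t₀
      obtain ⟨M, hM⟩ := hU.bounded (|t₀| + 1)
      refine ⟨M, ?_⟩
      filter_upwards [continuous_abs.continuousAt.eventually_le_const
        (show |t₀| < |t₀| + 1 by linarith)] with t ht using hM t ht
    have hlocp : ∀ p₀ : ℝ × (Fin j → Space d) × (Fin j → Space d), ∃ M : ℝ, ∀ᶠ p in 𝓝 p₀,
        ∀ j ξ η, ‖U p.1 j ξ η‖ ≤ M := by
      intro p₀
      obtain ⟨M, hM⟩ := hloc p₀.1
      exact ⟨M, continuous_fst.continuousAt.eventually hM⟩
    have hs : ∀ r : Fin j, Continuous fun h : Space d => (Pi.single r h : Fin j → Space d) :=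
      fun r => continuous_single (A := fun _ : Fin j => Space d) r
    unfold WignerHierarchy.interaction
    refine .add (.mul continuous_const ?_) (.mul continuous_const ?_)
    · unfold opT
      refine .mul continuous_const (continuous_finsetSum _ fun l _ =>
        continuous_finsetSum _ fun r _ => ?_)
      refine continuous_integral_kernel hΦ hħ
        (a := fun p : ℝ × (Fin j → Space d) × (Fin j → Space d) => p.2.2 r - p.2.2 l)
        (by fun_prop)
        (ψ := fun p h => U p.1 j (p.2.1 + Pi.single r h - Pi.single l h) p.2.2) ?_ ?_
      · have h1 := hs r
        have h2 := hs l
        exact (hU.continuous j).comp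
          (f := fun q : (ℝ × (Fin j → Space d) × (Fin j → Space d)) × Space d =>
            (q.1.1, q.1.2.1 + Pi.single r q.2 - Pi.single l q.2, q.1.2.2)) (by fun_prop)
      · intro p₀
        obtain ⟨M, hM⟩ := hlocp p₀
        exact ⟨M, hM.mono fun p hp h => hp _ _ _⟩
    · unfold opC
      refine continuous_finsetSum _ fun r _ => ?_
      refine continuous_integral_kernel hΦ hħ
        (a := fun p : ℝ × (Fin j → Space d) × (Fin j → Space d) => p.2.2 r) (by fun_prop)
        (ψ := fun p h => U p.1 (j + 1)
          (Fin.snoc (α := fun _ => Space d) (p.2.1 + Pi.single r h) (-h))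
          (Fin.snoc (α := fun _ => Space d) p.2.2 0)) ?_ ?_
      · have h1 := hs r
        have e1 : Continuous fun q : (ℝ × (Fin j → Space d) × (Fin j → Space d)) × Space d =>
            (q.1.2.1 + Pi.single r q.2 : Fin j → Space d) := by fun_prop
        have e2 : Continuous fun q : (ℝ × (Fin j → Space d) × (Fin j → Space d)) × Space d =>
            (q.1.2.2 : Fin j → Space d) := by fun_prop
        have e3 : Continuous fun q : (ℝ × (Fin j → Space d) × (Fin j → Space d)) × Space d =>
            q.1.1 := by fun_prop
        exact (hU.continuous (j + 1)).comp (e3.prodMk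
          ((e1.finSnoc (A := fun _ => Space d) continuous_snd.neg).prodMk
            (e2.finSnoc (A := fun _ => Space d) continuous_const)))
      · intro p₀
        obtain ⟨M, hM⟩ := hlocp p₀
        exact ⟨M, hM.mono fun p hp h => hp _ _ _⟩
  bounded τ := by
    obtain ⟨M, hM⟩ := hU.bounded τ
    exact ⟨_, fun t ht => norm_interaction_le hΦ hħ (hU.truncated t) (hM t ht)⟩
  truncated t := interaction_eq_zero (hU.truncated t)

/-- `∫₀ᵗ S(t-s) (T^N + C^N) U(s) ds`, the integral term of the mild form of the hierarchy. -/
noncomputable def duhamel (Φhat : Space d → ℂ) (ħ : ℝ) (N : ℕ)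
    (U : ℝ → ∀ j : ℕ, FourierFun d j) : ℝ → ∀ j : ℕ, FourierFun d j :=
  fun t j ξ η => ∫ s in (0 : ℝ)..t, transport (t - s) (interaction Φhat ħ N (U s) j) ξ η

theorem norm_integral_le_of_norm_le_pow {f : ℝ → ℂ} {t c : ℝ} (n : ℕ)
    (hf : ∀ s, |s| ≤ |t| → ‖f s‖ ≤ c * |s| ^ n) :
    ‖∫ s in (0 : ℝ)..t, f s‖ ≤ c * |t| ^ (n + 1) / (n + 1) := by
  have h1 : ∀ s ∈ Set.uIoc 0 t, |s| ≤ |t| := by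
    intro s hs
    simpa using Set.abs_sub_left_of_mem_uIcc (Set.uIoc_subset_uIcc hs)
  rw [intervalIntegral.norm_integral_eq_norm_integral_uIoc]
  have h2 : ∫ s in Set.uIoc 0 t, c * |s| ^ n = c * |t| ^ (n + 1) / (n + 1) := by
    have := integral_pow_abs_sub_uIoc (a := 0) (b := t) (n := n)
    simp only [sub_zero] at this
    rw [integral_const_mul, this, mul_div_assoc]
  rw [← h2]
  refine norm_integral_le_of_norm_le ?_ ?_
  · exact ((by fun_prop : Continuous fun s : ℝ => c * |s| ^ n).intervalIntegrable 0 t).def'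
  · exact (ae_restrict_mem measurableSet_uIoc).mono fun s hs => hf s (h1 s hs)

theorem IsAdmissible.continuous_transport {N : ℕ} {G : ℝ → ∀ j : ℕ, FourierFun d j}
    (hG : IsAdmissible N G) (t : ℝ) (j : ℕ) (ξ η : Fin j → Space d) :
    Continuous fun s : ℝ => transport (t - s) (G s j) ξ η :=
  (hG.continuous j).comp (f := fun s : ℝ => (s, ξ, η - (t - s) • ξ)) (by fun_prop)

theorem norm_duhamel_le {Φhat : Space d → ℂ} (hΦ : Integrable Φhat) {ħ : ℝ} (hħ : 0 < ħ)
    {N : ℕ} {U : ℝ → ∀ j : ℕ, FourierFun d j} (hU : IsAdmissible N U) {t c : ℝ} (n : ℕ)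
    (hc : ∀ s, |s| ≤ |t| → ∀ j ξ η, ‖U s j ξ η‖ ≤ c * |s| ^ n)
    (j : ℕ) (ξ η : Fin j → Space d) :
    ‖duhamel Φhat ħ N U t j ξ η‖ ≤
      interactionBound Φhat ħ N * c * |t| ^ (n + 1) / (n + 1) := by
  refine norm_integral_le_of_norm_le_pow n fun s hs => ?_
  rw [mul_assoc]
  exact norm_interaction_le hΦ hħ (hU.truncated s) (hc s hs) j ξ _

theorem IsAdmissible.duhamel {Φhat : Space d → ℂ} (hΦ : Integrable Φhat) {ħ : ℝ} (hħ : 0 < ħ)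
    {N : ℕ} {U : ℝ → ∀ j : ℕ, FourierFun d j} (hU : IsAdmissible N U) :
    IsAdmissible N (duhamel Φhat ħ N U) where
  continuous j := by
    have hI := (hU.interaction hΦ hħ).continuous j
    unfold WignerHierarchy.duhamel transport
    refine intervalIntegral.continuous_parametric_intervalIntegral_of_continuous
      (f := fun (p : ℝ × (Fin j → Space d) × (Fin j → Space d)) (s : ℝ) =>
        WignerHierarchy.interaction Φhat ħ N (U s) j p.2.1 (p.2.2 - (p.1 - s) • p.2.1))
      ?_ continuous_fst
    exact hI.comp (f := fun q : (ℝ × (Fin j → Space d) × (Fin j → Space d)) × ℝ =>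
      (q.2, q.1.2.1, q.1.2.2 - (q.1.1 - q.2) • q.1.2.1)) (by fun_prop)
  bounded τ := by
    obtain ⟨M, hM⟩ := hU.bounded τ
    refine ⟨interactionBound Φhat ħ N * M * τ, fun t ht j ξ η => ?_⟩
    have h := norm_duhamel_le hΦ hħ hU (t := t) (c := M) 0
      (fun s hs j ξ η => by simpa using hM s (hs.trans ht) j ξ η) j ξ η
    have hM0 : 0 ≤ M := (norm_nonneg _).trans (hM t ht j ξ η)
    have hB := interactionBound_nonneg Φhat hħ N
    calc _ ≤ _ := h
      _ = interactionBound Φhat ħ N * M * |t| := by simp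
      _ ≤ _ := by gcongr
  truncated t j hj := by
    ext ξ η
    have : ∀ s, WignerHierarchy.interaction Φhat ħ N (U s) j = 0 := fun s =>
      interaction_eq_zero (hU.truncated s) j hj
    simp [WignerHierarchy.duhamel, transport, this]

theorem duhamel_sub {Φhat : Space d → ℂ} (hΦ : Integrable Φhat) {ħ : ℝ} (hħ : 0 < ħ)
    {N : ℕ} {U V : ℝ → ∀ j : ℕ, FourierFun d j} (hU : IsAdmissible N U) (hV : IsAdmissible N V) :
    duhamel Φhat ħ N (U - V) = duhamel Φhat ħ N U - duhamel Φhat ħ N V := by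
  ext t j ξ η
  have hi : ∀ {W : ℝ → ∀ j : ℕ, FourierFun d j}, IsAdmissible N W → IntervalIntegrable
      (fun s => transport (t - s) (interaction Φhat ħ N (W s) j) ξ η) volume 0 t :=
    fun hW => ((hW.interaction hΦ hħ).continuous_transport t j ξ η).intervalIntegrable _ _
  simp only [Pi.sub_apply, duhamel]
  rw [← intervalIntegral.integral_sub (hi hU) (hi hV)]
  refine intervalIntegral.integral_congr fun s _ => ?_
  exact interaction_sub hΦ hħ (hU.isRegular s) (hV.isRegular s) j ξ _

/-! ### The Dyson expansion on bounded sequences -/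

theorem exists_factorizedData_le (N : ℕ) (fin : WignerDistribution d 1) :
    ∃ M : ℝ, ∀ j ξ η, ‖factorizedData N fin j ξ η‖ ≤ M := by
  obtain ⟨m, hm⟩ := fin.ft_bounded
  refine ⟨max 1 m ^ N, fun j ξ η => ?_⟩
  unfold factorizedData
  split_ifs with h
  · rw [norm_prod]
    calc ∏ i : Fin j, ‖fin.ft (fun _ => ξ i) (fun _ => η i)‖ ≤ ∏ i : Fin j, max 1 m :=
          Finset.prod_le_prod (fun _ _ => norm_nonneg _) fun i _ =>
            (hm _ _).trans (le_max_right _ _)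
      _ = max 1 m ^ j := by simp
      _ ≤ _ := pow_le_pow_right₀ (le_max_left _ _) h.2
  · simp

theorem continuous_factorizedData (N : ℕ) (fin : WignerDistribution d 1) (j : ℕ) :
    Continuous fun p : (Fin j → Space d) × (Fin j → Space d) =>
      factorizedData N fin j p.1 p.2 := by
  unfold factorizedData
  split_ifs
  · refine continuous_finsetProd _ fun i _ => ?_
    exact fin.ft_continuous.comp
      (f := fun p : (Fin j → Space d) × (Fin j → Space d) =>
        ((fun _ => p.1 i, fun _ => p.2 i) : (Fin 1 → Space d) × (Fin 1 → Space d)))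
      (by fun_prop)
  · exact continuous_const

theorem isTruncated_factorizedData (N : ℕ) (fin : WignerDistribution d 1) :
    IsTruncated N (factorizedData N fin) := by
  intro j hj
  ext ξ η
  simp [factorizedData, hj]

theorem isAdmissible_dysonTerm {Φhat : Space d → ℂ} (hΦ : Integrable Φhat) {ħ : ℝ} (hħ : 0 < ħ)
    (N : ℕ) (fin : WignerDistribution d 1) (n : ℕ) :
    IsAdmissible N (dysonTerm Φhat ħ N fin n) := by
  induction n with
  | zero =>
    refine ⟨fun j => ?_, fun τ => ?_, fun t j hj => ?_⟩
    · exact (continuous_factorizedData N fin j).comp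
        (f := fun p : ℝ × (Fin j → Space d) × (Fin j → Space d) =>
          (p.2.1, p.2.2 - p.1 • p.2.1)) (by fun_prop)
    · obtain ⟨M, hM⟩ := exists_factorizedData_le N fin
      exact ⟨M, fun t _ j ξ η => hM j _ _⟩
    · ext ξ η
      simp [dysonTerm, transport, isTruncated_factorizedData N fin j hj]
  | succ n ih => exact ih.duhamel hΦ hħ

theorem norm_dysonTerm_le {Φhat : Space d → ℂ} (hΦ : Integrable Φhat) {ħ : ℝ} (hħ : 0 < ħ)
    {N : ℕ} {fin : WignerDistribution d 1} {M : ℝ}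
    (hM : ∀ j ξ η, ‖factorizedData N fin j ξ η‖ ≤ M) (n : ℕ) (t : ℝ) (j : ℕ)
    (ξ η : Fin j → Space d) :
    ‖dysonTerm Φhat ħ N fin n t j ξ η‖ ≤
      M * (interactionBound Φhat ħ N * |t|) ^ n / n.factorial := by
  induction n generalizing t j with
  | zero => simpa [dysonTerm, transport] using hM j ξ (η - t • ξ)
  | succ n ih =>
    have := norm_duhamel_le hΦ hħ (isAdmissible_dysonTerm hΦ hħ N fin n) (t := t)
      (c := M * interactionBound Φhat ħ N ^ n / n.factorial) n
      (fun s _ j ξ η => (ih s j ξ η).trans_eq (by ring)) j ξ η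
    refine this.trans_eq ?_
    rw [Nat.factorial_succ]
    push_cast
    field_simp
    ring

/-- The sum of the first `n` terms of the Dyson expansion. -/
noncomputable def dysonPartial (Φhat : Space d → ℂ) (ħ : ℝ) (N : ℕ)
    (fin : WignerDistribution d 1) (n : ℕ) : ℝ → ∀ j : ℕ, FourierFun d j :=
  ∑ k ∈ Finset.range n, dysonTerm Φhat ħ N fin k

theorem dysonPartial_apply (Φhat : Space d → ℂ) (ħ : ℝ) (N : ℕ) (fin : WignerDistribution d 1)
    (n : ℕ) (t : ℝ) (j : ℕ) (ξ η : Fin j → Space d) :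
    dysonPartial Φhat ħ N fin n t j ξ η =
      ∑ k ∈ Finset.range n, dysonTerm Φhat ħ N fin k t j ξ η := by
  simp [dysonPartial, Finset.sum_apply]

theorem isAdmissible_dysonPartial {Φhat : Space d → ℂ} (hΦ : Integrable Φhat) {ħ : ℝ}
    (hħ : 0 < ħ) (N : ℕ) (fin : WignerDistribution d 1) (n : ℕ) :
    IsAdmissible N (dysonPartial Φhat ħ N fin n) := by
  induction n with
  | zero => exact IsAdmissible.zero N
  | succ n ih =>
    rw [dysonPartial, Finset.sum_range_succ]
    exact ih.add (isAdmissible_dysonTerm hΦ hħ N fin n)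

/-- One Picard step turns the error of the `n`-th partial sum into that of the next one. -/
theorem dysonTerm_zero_add_duhamel_sub {Φhat : Space d → ℂ} (hΦ : Integrable Φhat) {ħ : ℝ}
    (hħ : 0 < ħ) {N : ℕ} (fin : WignerDistribution d 1) {U : ℝ → ∀ j : ℕ, FourierFun d j}
    (hU : IsAdmissible N U) (n : ℕ) :
    dysonTerm Φhat ħ N fin 0 + duhamel Φhat ħ N U - dysonPartial Φhat ħ N fin (n + 1) =
      duhamel Φhat ħ N (U - dysonPartial Φhat ħ N fin n) := by
  induction n with
  | zero => simp [dysonPartial]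
  | succ n ih =>
    have h1 : U - dysonPartial Φhat ħ N fin (n + 1) =
        (U - dysonPartial Φhat ħ N fin n) - dysonTerm Φhat ħ N fin n := by
      rw [dysonPartial, Finset.sum_range_succ, ← dysonPartial, sub_sub]
    rw [h1, duhamel_sub hΦ hħ (hU.sub (isAdmissible_dysonPartial hΦ hħ N fin n))
      (isAdmissible_dysonTerm hΦ hħ N fin n), ← ih, dysonPartial, Finset.sum_range_succ,
      ← dysonPartial, ← sub_sub]
    rfl

/-- The mild form `U(t) = S(t) f^{in} + ∫₀ᵗ S(t-s) (T^N + C^N) U(s) ds` of the hierarchy. -/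
def IsMildSolution (Φhat : Space d → ℂ) (ħ : ℝ) (N : ℕ) (fin : WignerDistribution d 1)
    (U : ℝ → ∀ j : ℕ, FourierFun d j) : Prop :=
  IsAdmissible N U ∧ U = dysonTerm Φhat ħ N fin 0 + duhamel Φhat ħ N U

/-- The remainder after `n` terms is the `n`-fold iterate of the Duhamel operator on `U`. -/
theorem IsMildSolution.norm_sub_dysonPartial_le {Φhat : Space d → ℂ} (hΦ : Integrable Φhat)
    {ħ : ℝ} (hħ : 0 < ħ) {N : ℕ} {fin : WignerDistribution d 1}
    {U : ℝ → ∀ j : ℕ, FourierFun d j} (hU : IsMildSolution Φhat ħ N fin U) {τ M : ℝ}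
    (hM : ∀ t, |t| ≤ τ → ∀ j ξ η, ‖U t j ξ η‖ ≤ M) (n : ℕ) {t : ℝ} (ht : |t| ≤ τ) (j : ℕ)
    (ξ η : Fin j → Space d) :
    ‖(U - dysonPartial Φhat ħ N fin n) t j ξ η‖ ≤
      M * (interactionBound Φhat ħ N * |t|) ^ n / n.factorial := by
  induction n generalizing t j with
  | zero => simpa [dysonPartial] using hM t ht j ξ η
  | succ n ih =>
    have h1 : U - dysonPartial Φhat ħ N fin (n + 1) =
        duhamel Φhat ħ N (U - dysonPartial Φhat ħ N fin n) := by
      conv_lhs => rw [hU.2]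
      exact dysonTerm_zero_add_duhamel_sub hΦ hħ fin hU.1 n
    have := norm_duhamel_le hΦ hħ (hU.1.sub (isAdmissible_dysonPartial hΦ hħ N fin n)) (t := t)
      (c := M * interactionBound Φhat ħ N ^ n / n.factorial) n
      (fun s hs j ξ η => (ih (hs.trans ht) j ξ η).trans_eq (by ring)) j ξ η
    rw [h1]
    refine this.trans_eq ?_
    rw [Nat.factorial_succ]
    push_cast
    field_simp
    ring

theorem summable_mul_pow_div_factorial (M x : ℝ) :
    Summable fun n : ℕ => M * x ^ n / n.factorial := by
  simpa only [mul_div_assoc] using (Real.summable_pow_div_factorial x).mul_left M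

theorem summable_dysonTerm {Φhat : Space d → ℂ} (hΦ : Integrable Φhat) {ħ : ℝ}
    (hħ : 0 < ħ) (N : ℕ) (fin : WignerDistribution d 1) (t : ℝ) (j : ℕ)
    (ξ η : Fin j → Space d) : Summable fun n => dysonTerm Φhat ħ N fin n t j ξ η := by
  obtain ⟨M, hM⟩ := exists_factorizedData_le N fin
  exact .of_norm_bounded (summable_mul_pow_div_factorial M _)
    fun n => norm_dysonTerm_le hΦ hħ hM n t j ξ η

/-- Every mild solution is the sum of the Dyson expansion. -/
theorem IsMildSolution.hasSum_dysonTerm {Φhat : Space d → ℂ} (hΦ : Integrable Φhat)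
    {ħ : ℝ} (hħ : 0 < ħ) {N : ℕ} {fin : WignerDistribution d 1}
    {U : ℝ → ∀ j : ℕ, FourierFun d j} (hU : IsMildSolution Φhat ħ N fin U) (t : ℝ) (j : ℕ)
    (ξ η : Fin j → Space d) :
    HasSum (fun n => dysonTerm Φhat ħ N fin n t j ξ η) (U t j ξ η) := by
  have hs := summable_dysonTerm hΦ hħ N fin t j ξ η
  obtain ⟨M, hM⟩ := hU.1.bounded |t|
  have h1 : Tendsto (fun n => dysonPartial Φhat ħ N fin n t j ξ η) atTop
      (𝓝 (U t j ξ η)) := by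
    refine tendsto_iff_norm_sub_tendsto_zero.2 (squeeze_zero (fun _ => norm_nonneg _)
      (fun n => ?_) (summable_mul_pow_div_factorial M
        (interactionBound Φhat ħ N * |t|)).tendsto_atTop_zero)
    rw [norm_sub_rev]
    exact hU.norm_sub_dysonPartial_le hΦ hħ hM n le_rfl j ξ η
  simp only [dysonPartial_apply] at h1
  exact (hs.hasSum_iff_tendsto_nat).2 h1

/-- The Dyson series converges locally uniformly, and its sum `F` is a mild solution: the Picard
step maps the `n`-th partial sum to the next one, and both are close to `F`. -/
theorem exists_isMildSolution {Φhat : Space d → ℂ} (hΦ : Integrable Φhat)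
    {ħ : ℝ} (hħ : 0 < ħ) (N : ℕ) (fin : WignerDistribution d 1) :
    ∃ U, IsMildSolution Φhat ħ N fin U := by
  obtain ⟨M, hM⟩ := exists_factorizedData_le N fin
  have hB := interactionBound_nonneg Φhat hħ N
  set B := interactionBound Φhat ħ N
  have hM0 : 0 ≤ M := (norm_nonneg _).trans (hM 0 0 0)
  have hb : ∀ τ : ℝ, ∀ n t, |t| ≤ τ → ∀ j ξ η,
      ‖dysonTerm Φhat ħ N fin n t j ξ η‖ ≤ M * (B * τ) ^ n / n.factorial := by
    intro τ n t ht j ξ η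
    refine (norm_dysonTerm_le hΦ hħ hM n t j ξ η).trans ?_
    gcongr
  let F : ℝ → ∀ j : ℕ, FourierFun d j := fun t j ξ η => ∑' n, dysonTerm Φhat ħ N fin n t j ξ η
  have hF : IsAdmissible N F := by
    refine ⟨fun j => continuous_iff_continuousAt.2 fun p₀ => ?_, fun τ => ?_, fun t j hj => ?_⟩
    · have ho : IsOpen {p : ℝ × (Fin j → Space d) × (Fin j → Space d) | |p.1| < |p₀.1| + 1} :=
        isOpen_lt (by fun_prop) continuous_const
      refine ContinuousOn.continuousAt (continuousOn_tsum
        (fun n => ((isAdmissible_dysonTerm hΦ hħ N fin n).continuous j).continuousOn)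
        (summable_mul_pow_div_factorial M (B * (|p₀.1| + 1)))
        fun n p hp => hb _ n p.1 (le_of_lt hp) j p.2.1 p.2.2) (ho.mem_nhds ?_)
      simp
    · exact ⟨∑' n : ℕ, M * (B * τ) ^ n / n.factorial, fun t ht j ξ η =>
        tsum_of_norm_bounded (summable_mul_pow_div_factorial M (B * τ)).hasSum
          fun n => hb τ n t ht j ξ η⟩
    · ext ξ η
      have : ∀ n, dysonTerm Φhat ħ N fin n t j = 0 := fun n =>
        (isAdmissible_dysonTerm hΦ hħ N fin n).truncated t j hj
      simp [F, this]
  refine ⟨F, hF, ?_⟩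
  ext t j ξ η
  let ε : ℕ → ℝ := fun n => ∑' k : ℕ, M * (B * |t|) ^ (k + n) / (k + n).factorial
  have hε : Tendsto ε atTop (𝓝 0) :=
    tendsto_sum_nat_add fun k : ℕ => M * (B * |t|) ^ k / k.factorial
  have htail : ∀ n s, |s| ≤ |t| → ∀ j ξ η,
      ‖(F - dysonPartial Φhat ħ N fin n) s j ξ η‖ ≤ ε n := by
    intro n s hs j ξ η
    have h1 : (F - dysonPartial Φhat ħ N fin n) s j ξ η =
        ∑' k, dysonTerm Φhat ħ N fin (k + n) s j ξ η := by
      simp only [Pi.sub_apply, dysonPartial_apply, F]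
      rw [← (summable_dysonTerm hΦ hħ N fin s j ξ η).sum_add_tsum_nat_add n]
      ring
    rw [h1]
    exact tsum_of_norm_bounded
      ((summable_nat_add_iff n).2 (summable_mul_pow_div_factorial M (B * |t|))).hasSum
      fun k => hb |t| (k + n) s hs j ξ η
  have hle : ∀ n, ‖F t j ξ η - (dysonTerm Φhat ħ N fin 0 + duhamel Φhat ħ N F) t j ξ η‖ ≤
      ε (n + 1) + B * ε n * |t| := by
    intro n
    have h1 := htail (n + 1) t le_rfl j ξ η
    have h2 := norm_duhamel_le hΦ hħ (hF.sub (isAdmissible_dysonPartial hΦ hħ N fin n)) (t := t)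
      (c := ε n) 0 (fun s hs j ξ η => by simpa using htail n s hs j ξ η) j ξ η
    rw [← dysonTerm_zero_add_duhamel_sub hΦ hħ fin hF n] at h2
    have h3 := norm_sub_le_of_le h1 h2
    simp only [Pi.sub_apply, sub_sub_sub_cancel_right] at h3
    exact h3.trans_eq (by simp [B])
  have hlim : Tendsto (fun n => ε (n + 1) + B * ε n * |t|) atTop (𝓝 0) := by
    simpa using ((tendsto_add_atTop_iff_nat 1).2 hε).add ((hε.const_mul B).mul_const |t|)
  have := ge_of_tendsto' hlim hle
  exact sub_eq_zero.1 (norm_le_zero_iff.1 this)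

/-! ### Solutions and mild solutions -/

theorem IsSolution.isMildSolution {Φhat : Space d → ℂ} (hΦ : Integrable Φhat)
    {ħ : ℝ} (hħ : 0 < ħ) {N : ℕ} {fin : WignerDistribution d 1}
    {f : ℝ → ∀ j : ℕ, WignerDistribution d j} (hf : IsSolution Φhat ħ N fin f) :
    IsMildSolution Φhat ħ N fin fun t j => (f t j).ft := by
  have hadm : IsAdmissible N fun t j => (f t j).ft := by
    refine ⟨hf.continuous, fun τ => ?_, hf.vanish⟩
    choose M hM using fun j => hf.locally_bounded j τ
    refine ⟨∑ j ∈ Finset.range (N + 1), |M j|, fun t ht j ξ η => ?_⟩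
    by_cases hj : 1 ≤ j ∧ j ≤ N
    · exact ((hM j t ht ξ η).trans (le_abs_self _)).trans
        (Finset.single_le_sum (f := fun j => |M j|) (fun _ _ => abs_nonneg _)
          (Finset.mem_range.2 (by omega)))
    · rw [hf.vanish t j hj]
      simpa using Finset.sum_nonneg fun _ _ => abs_nonneg _
  refine ⟨hadm, ?_⟩
  ext t j ξ η
  by_cases hj : 1 ≤ j ∧ j ≤ N
  · have h1 := intervalIntegral.integral_eq_sub_of_hasDerivAt (a := 0) (b := t)
      (f := fun s => (f s j).ft ξ (η + (s - t) • ξ))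
      (f' := fun s => transport (t - s) (interaction Φhat ħ N (fun k => (f s k).ft) j) ξ η)
      (fun s _ => by
        -- the characteristic through `(t, ξ, η)` meets time `s` at `(ξ, η - (t - s)ξ)`
        have := hf.equation j hj.1 hj.2 s ξ (η - (t - s) • ξ)
        have e : ∀ r, η - (t - s) • ξ + (r - s) • ξ = η + (r - t) • ξ := fun r => by
          simp only [sub_smul]; abel
        simp only [e] at this
        exact this)
      (((hadm.interaction hΦ hħ).continuous_transport t j ξ η).intervalIntegrable _ _)
    have h2 : (dysonTerm Φhat ħ N fin 0 + duhamel Φhat ħ N fun t j => (f t j).ft) t j ξ η =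
        factorizedData N fin j ξ (η - t • ξ) +
          ∫ s in (0 : ℝ)..t,
            transport (t - s) (interaction Φhat ħ N (fun k => (f s k).ft) j) ξ η := rfl
    rw [h2, h1, hf.initial j]
    simp [sub_eq_add_neg]
  · rw [hf.vanish t j hj]
    simp [dysonTerm, transport, isTruncated_factorizedData N fin j hj,
      (hadm.duhamel hΦ hħ).truncated t j hj]

theorem IsMildSolution.hasDerivAt {Φhat : Space d → ℂ} (hΦ : Integrable Φhat)
    {ħ : ℝ} (hħ : 0 < ħ) {N : ℕ} {fin : WignerDistribution d 1}
    {U : ℝ → ∀ j : ℕ, FourierFun d j} (hU : IsMildSolution Φhat ħ N fin U) (j : ℕ) (t : ℝ)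
    (ξ η : Fin j → Space d) :
    HasDerivAt (fun s : ℝ => U s j ξ (η + (s - t) • ξ)) (interaction Φhat ħ N (U t) j ξ η) t := by
  have h1 : (fun s : ℝ => U s j ξ (η + (s - t) • ξ)) = fun s =>
      factorizedData N fin j ξ (η - t • ξ) +
        ∫ r in (0 : ℝ)..s, transport (t - r) (interaction Φhat ħ N (U r) j) ξ η := by
    ext s
    conv_lhs => rw [hU.2]
    have e0 : η + (s - t) • ξ - s • ξ = η - t • ξ := by simp only [sub_smul]; abel
    have e : ∀ r, η + (s - t) • ξ - (s - r) • ξ = η - (t - r) • ξ := fun r => by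
      simp only [sub_smul]; abel
    simp only [Pi.add_apply, dysonTerm, duhamel, transport, e0, e]
  rw [h1]
  have hc := (hU.1.interaction hΦ hħ).continuous_transport t j ξ η
  have h2 := (hc.integral_hasStrictDerivAt 0 t).hasDerivAt.const_add
    (factorizedData N fin j ξ (η - t • ξ))
  simpa [transport] using h2

theorem IsMildSolution.exists_isSolution {Φhat : Space d → ℂ} (hΦ : Integrable Φhat)
    {ħ : ℝ} (hħ : 0 < ħ) {N : ℕ} {fin : WignerDistribution d 1}
    {U : ℝ → ∀ j : ℕ, FourierFun d j} (hU : IsMildSolution Φhat ħ N fin U) :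
    ∃ f, IsSolution Φhat ħ N fin f := by
  choose f hf using fun t j => WignerDistribution.exists_ft_eq (U t j)
    (hU.1.isRegular t j).1 (hU.1.isRegular t j).2
  refine ⟨f, ?_, ?_, ?_, ?_, ?_⟩
  · simpa only [hf] using hU.1.continuous
  · simp only [hf]
    intro j τ
    obtain ⟨M, hM⟩ := hU.1.bounded τ
    exact ⟨M, fun t ht => hM t ht j⟩
  · intro t j hj
    rw [hf]
    exact hU.1.truncated t j hj
  · intro j
    rw [hf, hU.2]
    ext ξ η
    simp [dysonTerm, transport, duhamel]
  · simp only [hf]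
    exact fun j _ _ t => hU.hasDerivAt hΦ hħ j t

/-- Uniqueness holds because the Dyson expansion, which depends on the data only, determines every
solution. -/
theorem existsUnique_isSolution {Φhat : Space d → ℂ} (hΦ : Integrable Φhat)
    {ħ : ℝ} (hħ : 0 < ħ) (N : ℕ) (fin : WignerDistribution d 1) :
    ∃! f : ℝ → ∀ j : ℕ, WignerDistribution d j, IsSolution Φhat ħ N fin f := by
  obtain ⟨U, hU⟩ := exists_isMildSolution hΦ hħ N fin
  obtain ⟨f, hf⟩ := hU.exists_isSolution hΦ hħ
  refine ⟨f, hf, fun g hg => funext fun t => funext fun j => WignerDistribution.ext_ft ?_⟩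
  ext ξ η
  exact ((hg.isMildSolution hΦ hħ).hasSum_dysonTerm hΦ hħ t j ξ η).unique
    ((hf.isMildSolution hΦ hħ).hasSum_dysonTerm hΦ hħ t j ξ η)

/-! ### Exponentially weighted estimates -/

/-- The exponent `∑ᵢ (|ξᵢ| + |ηᵢ|)` of the weight in `‖·‖_ρ`. -/
noncomputable def phaseWeight {j : ℕ} (ξ η : Fin j → Space d) : ℝ := ∑ i, (‖ξ i‖ + ‖η i‖)

theorem phaseWeight_nonneg {j : ℕ} (ξ η : Fin j → Space d) : 0 ≤ phaseWeight ξ η :=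
  Finset.sum_nonneg fun _ _ => by positivity

theorem phaseWeight_le_add {j : ℕ} (ξ η ξ' η' : Fin j → Space d) :
    phaseWeight ξ η ≤ phaseWeight ξ' η' + phaseWeight (ξ - ξ') (η - η') := by
  unfold phaseWeight
  rw [← Finset.sum_add_distrib]
  refine Finset.sum_le_sum fun i _ => ?_
  have h1 := norm_add_le (ξ' i) (ξ i - ξ' i)
  have h2 := norm_add_le (η' i) (η i - η' i)
  rw [add_sub_cancel] at h1 h2
  simp only [Pi.sub_apply]
  linarith

theorem phaseWeight_smul_right {j : ℕ} (s : ℝ) (ξ : Fin j → Space d) :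
    phaseWeight ξ (s • ξ) = (1 + |s|) * ∑ i, ‖ξ i‖ := by
  simp only [phaseWeight, Pi.smul_apply, norm_smul, Real.norm_eq_abs, Finset.mul_sum]
  exact Finset.sum_congr rfl fun _ _ => by ring

theorem sum_norm_single {j : ℕ} (r : Fin j) (h : Space d) :
    ∑ i, ‖(Pi.single r h : Fin j → Space d) i‖ = ‖h‖ := by
  rw [Finset.sum_eq_single r (fun i _ hi => by simp [Pi.single_eq_of_ne hi]) (by simp)]
  simp

/-- Free transport over the time `t` costs at most a factor `1 + |t|` in the exponent. -/
theorem phaseWeight_le_transport {j : ℕ} (t : ℝ) (ξ η : Fin j → Space d) :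
    phaseWeight ξ η ≤ (1 + |t|) * phaseWeight ξ (η - t • ξ) := by
  refine (phaseWeight_le_add ξ η ξ (η - t • ξ)).trans ?_
  have : phaseWeight (ξ - ξ) (η - (η - t • ξ)) ≤ |t| * phaseWeight ξ (η - t • ξ) := by
    simp only [phaseWeight, Finset.mul_sum, sub_self, sub_sub_cancel, Pi.smul_apply, norm_smul,
      Real.norm_eq_abs, Pi.zero_apply, norm_zero, zero_add]
    refine Finset.sum_le_sum fun i _ => ?_
    gcongr
    linarith [norm_nonneg ((η - t • ξ) i)]
  linarith

theorem norm_add_smul_le_of_abs_le_one {s : ℝ} (hs : |s| ≤ 1) (x y : Space d) :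
    ‖y + s • x‖ ≤ ‖x‖ + ‖y‖ := by
  refine (norm_add_le _ _).trans ?_
  rw [norm_smul, Real.norm_eq_abs]
  have := mul_le_of_le_one_left (norm_nonneg x) hs
  linarith

/-- The momentum exchange `h` between the particles `l` and `r` changes the exponent, read along
the free flow, by at most `2|h|(1 + |s|)`. -/
theorem phaseWeight_le_of_exchange {j : ℕ} (s : ℝ) (ξ η : Fin j → Space d) (l r : Fin j)
    (h : Space d) :
    phaseWeight ξ η ≤
      phaseWeight (ξ + Pi.single r h - Pi.single l h)
        (η + s • ξ - s • (ξ + Pi.single r h - Pi.single l h)) + 2 * ‖h‖ * (1 + |s|) := by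
  refine (phaseWeight_le_add ξ η (ξ + Pi.single r h - Pi.single l h)
    (η + s • ξ - s • (ξ + Pi.single r h - Pi.single l h))).trans ?_
  gcongr
  set k : Fin j → Space d := Pi.single l h - Pi.single r h
  have e1 : ξ - (ξ + Pi.single r h - Pi.single l h) = k := by simp only [k]; abel
  have e2 : η - (η + s • ξ - s • (ξ + Pi.single r h - Pi.single l h)) = s • (-k) := by
    simp only [k, smul_sub, smul_add, smul_neg]; abel
  have hk : ∑ i, ‖k i‖ ≤ 2 * ‖h‖ := by
    calc ∑ i, ‖k i‖ ≤ ∑ i, (‖(Pi.single l h : Fin j → Space d) i‖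
          + ‖(Pi.single r h : Fin j → Space d) i‖) :=
          Finset.sum_le_sum fun i _ => norm_sub_le _ _
      _ = 2 * ‖h‖ := by rw [Finset.sum_add_distrib, sum_norm_single, sum_norm_single]; ring
  have e3 : phaseWeight k (s • (-k)) = phaseWeight k (s • k) := by simp [phaseWeight]
  rw [e1, e2, e3, phaseWeight_smul_right, mul_comm]
  gcongr

/-- In the collision with an additional particle the shift of `ξ_r` by `h` is compensated by the
frequency `-h` of that particle. -/
theorem phaseWeight_le_of_collision {j : ℕ} (s : ℝ) (ξ η : Fin j → Space d) (r : Fin j)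
    (h : Space d) :
    phaseWeight ξ η ≤
      phaseWeight
        (Fin.snoc (α := fun _ => Space d) (ξ + Pi.single r h) (-h) : Fin (j + 1) → Space d)
        ((Fin.snoc (α := fun _ => Space d) (η + s • ξ) 0 : Fin (j + 1) → Space d) -
          s • (Fin.snoc (α := fun _ => Space d) (ξ + Pi.single r h) (-h) :
            Fin (j + 1) → Space d)) := by
  refine (phaseWeight_le_add ξ η (ξ + Pi.single r h)
    (η + s • ξ - s • (ξ + Pi.single r h))).trans ?_
  have e1 : ξ - (ξ + Pi.single r h) = -Pi.single r h := by abel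
  have e2 : η - (η + s • ξ - s • (ξ + Pi.single r h)) = s • Pi.single r h := by
    simp only [smul_add]; abel
  have e3 : phaseWeight (-Pi.single r h : Fin j → Space d) (s • Pi.single r h) =
      (1 + |s|) * ‖h‖ := by
    rw [← sum_norm_single r h, ← phaseWeight_smul_right]
    simp [phaseWeight]
  rw [e1, e2, e3]
  refine le_of_eq ?_
  unfold phaseWeight
  rw [Fin.sum_univ_castSucc]
  simp only [Fin.snoc_castSucc, Fin.snoc_last, Pi.sub_apply, Pi.smul_apply, norm_neg, smul_neg,
    sub_neg_eq_add, zero_add, norm_smul, Real.norm_eq_abs]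
  ring

theorem potentialConst_nonneg (Φhat : Space d → ℂ) (β t : ℝ) : 0 ≤ potentialConst Φhat β t :=
  integral_nonneg fun _ => by unfold potentialWeight; positivity

theorem norm_integral_kernel_le_potentialConst {Φhat : Space d → ℂ} {β' τ : ℝ}
    (hC : Integrable (potentialWeight Φhat β' τ)) {ħ : ℝ} (hħ : 0 < ħ) {a : Space d} {A K : ℝ}
    (ha : ‖a‖ ≤ A) {ψ : Space d → ℂ}
    (hψ : ∀ h, ‖ψ h‖ ≤ K * Real.exp (2 * β' * ‖h‖ * (1 + |τ|))) :
    ‖∫ h, Φhat h * ((2 * Real.sin (ħ / 2 * inner ℝ a h) / ħ : ℝ) : ℂ) * ψ h‖ ≤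
      A * (potentialConst Φhat β' τ * K) := by
  have : A * (potentialConst Φhat β' τ * K) = ∫ h, potentialWeight Φhat β' τ h * (A * K) := by
    rw [integral_mul_const, potentialConst]; ring
  rw [this]
  refine norm_integral_le_of_norm_le (hC.mul_const _) (.of_forall fun h => ?_)
  rw [norm_mul, norm_mul, Complex.norm_real, Real.norm_eq_abs]
  have hA : 0 ≤ A := (norm_nonneg _).trans ha
  calc _ ≤ ‖Φhat h‖ * (A * ‖h‖) * (K * Real.exp (2 * β' * ‖h‖ * (1 + |τ|))) := by
        gcongr
        · exact (abs_sin_kernel_le_norm hħ a h).trans (by gcongr)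
        · exact hψ h
    _ = _ := by unfold potentialWeight; ring

theorem sum_sum_ne_add_le {j : ℕ} {w : Fin j → ℝ} (hw : ∀ i, 0 ≤ w i) :
    ∑ l : Fin j, ∑ r ∈ Finset.univ.filter (fun r => r ≠ l), (w r + w l) ≤ 2 * j * ∑ i, w i := by
  calc _ ≤ ∑ l : Fin j, ∑ r : Fin j, (w r + w l) :=
        Finset.sum_le_sum fun l _ =>
          Finset.sum_le_sum_of_subset_of_nonneg (Finset.filter_subset _ _)
            fun r _ _ => add_nonneg (hw r) (hw l)
    _ = 2 * j * ∑ i, w i := by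
        simp only [Finset.sum_add_distrib, Finset.sum_const, Finset.card_univ,
          Fintype.card_fin, nsmul_eq_mul, ← Finset.mul_sum]
        ring

/-- Read along the free flow, `T_j` multiplies an exponential bound by
`j C_Φ ∑ᵢ (|ξᵢ| + |ηᵢ|)`, uniformly in `ħ`. The factor `j` is compensated by `1/N`. -/
theorem norm_opT_le_exp {Φhat : Space d → ℂ} {β' τ : ℝ}
    (hC : Integrable (potentialWeight Φhat β' τ)) (hτ : τ ≤ 1) {ħ : ℝ} (hħ : 0 < ħ) {ρ s K : ℝ}
    (hρ : 0 ≤ ρ) (hρβ : ρ ≤ β') (hs : |s| ≤ τ) (hK : 0 ≤ K) {j : ℕ} {φ : FourierFun d j}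
    (hφ : ∀ ξ η, ‖φ ξ η‖ ≤ K * Real.exp (-ρ * phaseWeight ξ (η - s • ξ)))
    (ξ η : Fin j → Space d) :
    ‖opT Φhat ħ j φ ξ (η + s • ξ)‖ ≤
      j * (K * (potentialConst Φhat β' τ * phaseWeight ξ η)
        * Real.exp (-ρ * phaseWeight ξ η)) := by
  have hC0 := potentialConst_nonneg Φhat β' τ
  obtain ⟨X, hXdef⟩ :
      ∃ X, X = potentialConst Φhat β' τ * (K * Real.exp (-ρ * phaseWeight ξ η)) := ⟨_, rfl⟩
  have hX : 0 ≤ X := hXdef ▸ by positivity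
  have hone : ∀ l r : Fin j,
      ‖∫ h : Space d, Φhat h * ((2 * Real.sin
          (ħ / 2 * inner ℝ ((η + s • ξ) r - (η + s • ξ) l) h) / ħ : ℝ) : ℂ)
          * φ (ξ + Pi.single r h - Pi.single l h) (η + s • ξ)‖ ≤
        ((‖ξ r‖ + ‖η r‖) + (‖ξ l‖ + ‖η l‖)) * X := by
    intro l r
    rw [hXdef]
    refine norm_integral_kernel_le_potentialConst hC hħ ?_ fun h => (hφ _ _).trans ?_
    · exact norm_sub_le_of_le (norm_add_smul_le_of_abs_le_one (hs.trans hτ) _ _)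
        (norm_add_smul_le_of_abs_le_one (hs.trans hτ) _ _)
    · rw [mul_assoc, ← Real.exp_add]
      have h1 := mul_le_mul_of_nonneg_left (phaseWeight_le_of_exchange s ξ η l r h) hρ
      have h2 : ρ * (2 * ‖h‖ * (1 + |s|)) ≤ β' * (2 * ‖h‖ * (1 + |τ|)) := by
        have hβ0 := hρ.trans hρβ
        have hsτ := hs.trans (le_abs_self τ)
        gcongr
      exact mul_le_mul_of_nonneg_left (Real.exp_le_exp.2 (by linarith)) hK
  have hsum : ‖∑ l : Fin j, ∑ r ∈ Finset.univ.filter (fun r => r ≠ l),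
        ∫ h : Space d, Φhat h * ((2 * Real.sin
          (ħ / 2 * inner ℝ ((η + s • ξ) r - (η + s • ξ) l) h) / ħ : ℝ) : ℂ)
          * φ (ξ + Pi.single r h - Pi.single l h) (η + s • ξ)‖
      ≤ 2 * j * phaseWeight ξ η * X := by
    refine (norm_sum_le_of_le _ fun l _ => norm_sum_le_of_le _ fun r _ => hone l r).trans ?_
    simp only [← Finset.sum_mul]
    exact mul_le_mul_of_nonneg_right
      (sum_sum_ne_add_le (w := fun i => ‖ξ i‖ + ‖η i‖) fun i => by positivity) hX
  unfold opT
  rw [norm_mul, show ‖(1 / 2 : ℂ)‖ = 1 / 2 by norm_num]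
  refine (mul_le_mul_of_nonneg_left hsum (by norm_num)).trans_eq ?_
  rw [hXdef]; ring

/-- Read along the free flow, `C_{j+1}` multiplies an exponential bound by
`C_Φ ∑ᵢ (|ξᵢ| + |ηᵢ|)`, uniformly in `ħ`. -/
theorem norm_opC_le_exp {Φhat : Space d → ℂ} {β' τ : ℝ}
    (hC : Integrable (potentialWeight Φhat β' τ)) (hτ : τ ≤ 1) {ħ : ℝ} (hħ : 0 < ħ) {ρ s K : ℝ}
    (hρ : 0 ≤ ρ) (hρβ : ρ ≤ β') (hs : |s| ≤ τ) (hK : 0 ≤ K) {j : ℕ} {φ : FourierFun d (j + 1)}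
    (hφ : ∀ ξ η, ‖φ ξ η‖ ≤ K * Real.exp (-ρ * phaseWeight ξ (η - s • ξ)))
    (ξ η : Fin j → Space d) :
    ‖opC Φhat ħ j φ ξ (η + s • ξ)‖ ≤
      K * (potentialConst Φhat β' τ * phaseWeight ξ η) * Real.exp (-ρ * phaseWeight ξ η) := by
  set X := potentialConst Φhat β' τ * (K * Real.exp (-ρ * phaseWeight ξ η))
  have hone : ∀ r : Fin j,
      ‖∫ h : Space d, Φhat h * ((2 * Real.sin (ħ / 2 * inner ℝ ((η + s • ξ) r) h) / ħ : ℝ) : ℂ)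
          * φ (Fin.snoc (α := fun _ => Space d) (ξ + Pi.single r h) (-h))
            (Fin.snoc (α := fun _ => Space d) (η + s • ξ) 0)‖ ≤ (‖ξ r‖ + ‖η r‖) * X := by
    intro r
    refine norm_integral_kernel_le_potentialConst hC hħ
      (norm_add_smul_le_of_abs_le_one (hs.trans hτ) _ _) fun h => (hφ _ _).trans ?_
    have h1 := mul_le_mul_of_nonneg_left (phaseWeight_le_of_collision s ξ η r h) hρ
    have h2 : 1 ≤ Real.exp (2 * β' * ‖h‖ * (1 + |τ|)) :=
      Real.one_le_exp (by have := hρ.trans hρβ; positivity)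
    calc _ ≤ K * Real.exp (-ρ * phaseWeight ξ η) :=
          mul_le_mul_of_nonneg_left (Real.exp_le_exp.2 (by linarith)) hK
      _ ≤ _ := le_mul_of_one_le_right (by positivity) h2
  unfold opC
  calc _ ≤ ∑ r : Fin j, (‖ξ r‖ + ‖η r‖) * X := norm_sum_le_of_le _ fun r _ => hone r
    _ = _ := by rw [← Finset.sum_mul, ← phaseWeight]; simp only [X]; ring

theorem norm_interaction_le_exp {Φhat : Space d → ℂ} {β' τ : ℝ}
    (hC : Integrable (potentialWeight Φhat β' τ)) (hτ : τ ≤ 1) {ħ : ℝ} (hħ : 0 < ħ) {ρ s : ℝ}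
    (hρ : 0 ≤ ρ) (hρβ : ρ ≤ β') (hs : |s| ≤ τ) {K : ℕ → ℝ} (hK : ∀ j, 0 ≤ K j) {N : ℕ}
    {u : ∀ j : ℕ, FourierFun d j} (hu : IsTruncated N u)
    (hb : ∀ j ξ η, ‖u j ξ η‖ ≤ K j * Real.exp (-ρ * phaseWeight ξ (η - s • ξ)))
    (j : ℕ) (ξ η : Fin j → Space d) :
    ‖interaction Φhat ħ N u j ξ (η + s • ξ)‖ ≤
      (K j + K (j + 1)) * (potentialConst Φhat β' τ * phaseWeight ξ η)
        * Real.exp (-ρ * phaseWeight ξ η) := by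
  have hC0 := potentialConst_nonneg Φhat β' τ
  have hW := phaseWeight_nonneg ξ η
  have hK0 := hK j
  have hK1 := hK (j + 1)
  by_cases hj : 1 ≤ j ∧ j ≤ N
  · have hN : (0 : ℝ) < N := by exact_mod_cast hj.1.trans hj.2
    have hjN : (j : ℝ) ≤ N := by exact_mod_cast hj.2
    have e1 : ‖(1 / (N : ℂ))‖ = 1 / N := by simp
    have e2 : ‖((N : ℂ) - (j : ℂ)) / (N : ℂ)‖ ≤ 1 := by
      rw [norm_div, show (N : ℂ) - (j : ℂ) = ((N - j : ℝ) : ℂ) by push_cast; rfl,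
        Complex.norm_real, Complex.norm_natCast, Real.norm_of_nonneg (by linarith),
        div_le_one hN]
      linarith [(Nat.cast_nonneg j : (0 : ℝ) ≤ j)]
    unfold interaction
    refine (norm_add_le _ _).trans ?_
    rw [norm_mul, norm_mul, e1]
    have h1 := norm_opT_le_exp hC hτ hħ hρ hρβ hs hK0 (hb j) ξ η
    have h2 := norm_opC_le_exp hC hτ hħ hρ hρβ hs hK1 (hb (j + 1)) ξ η
    calc _ ≤ 1 / N * (N * (K j * (potentialConst Φhat β' τ * phaseWeight ξ η)
              * Real.exp (-ρ * phaseWeight ξ η)))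
          + 1 * (K (j + 1) * (potentialConst Φhat β' τ * phaseWeight ξ η)
              * Real.exp (-ρ * phaseWeight ξ η)) := by
          gcongr
          refine h1.trans ?_
          gcongr
      _ = _ := by field_simp
  · rw [interaction_eq_zero hu j hj]
    simp only [Pi.zero_apply, norm_zero]
    positivity

/-- The combinatorial factors of the Dyson terms: each application of `T^N + C^N` to the `j`-th
entry involves the entries `j` and `j + 1`, with coefficients at most `1`. -/
def cascade (F : ℕ → ℝ) : ℕ → ℕ → ℝ
  | 0, j => F j
  | n + 1, j => cascade F n j + cascade F n (j + 1)

theorem cascade_nonneg {F : ℕ → ℝ} (hF : ∀ j, 0 ≤ F j) (n j : ℕ) : 0 ≤ cascade F n j := by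
  induction n generalizing j with
  | zero => exact hF j
  | succ n ih => exact add_nonneg (ih j) (ih (j + 1))

/-- The loss of the factor `∑ᵢ (|ξᵢ| + |ηᵢ|)` is paid by lowering the exponential rate by `δ`. -/
theorem mul_exp_neg_le {δ : ℝ} (hδ : 0 < δ) (x y : ℝ) :
    x * Real.exp (-y * x) ≤ 1 / (Real.exp 1 * δ) * Real.exp (-(y - δ) * x) := by
  have h1 : δ * x ≤ Real.exp (δ * x - 1) := by linarith [Real.add_one_le_exp (δ * x - 1)]
  have h2 : Real.exp (-(y - δ) * x) = Real.exp 1 * (Real.exp (δ * x - 1) * Real.exp (-y * x)) := by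
    rw [← Real.exp_add, ← Real.exp_add]; congr 1; ring
  rw [h2]
  have h3 : 1 / (Real.exp 1 * δ) * (Real.exp 1 * (Real.exp (δ * x - 1) * Real.exp (-y * x))) =
      Real.exp (δ * x - 1) * Real.exp (-y * x) / δ := by
    field_simp
  rw [h3, le_div_iff₀ hδ]
  nlinarith [mul_le_mul_of_nonneg_right h1 (Real.exp_pos (-y * x)).le]

/-- The Dyson terms read along the free flow. Each interaction lowers the exponential rate by `δ`. -/
theorem norm_dysonTerm_le_exp {Φhat : Space d → ℂ} (hΦ : Integrable Φhat) {β' τ : ℝ}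
    (hC : Integrable (potentialWeight Φhat β' τ)) (hτ : τ ≤ 1) {ħ : ℝ} (hħ : 0 < ħ)
    {N : ℕ} {fin : WignerDistribution d 1} {F : ℕ → ℝ} (hF0 : ∀ j, 0 ≤ F j)
    (hF : ∀ j ξ η, ‖factorizedData N fin j ξ η‖ ≤ F j * Real.exp (-β' * phaseWeight ξ η))
    {δ : ℝ} (hδ : 0 < δ) (n : ℕ) (hn : n * δ ≤ β') {t : ℝ} (ht : |t| ≤ τ) (j : ℕ)
    (ξ η : Fin j → Space d) :
    ‖dysonTerm Φhat ħ N fin n t j ξ (η + t • ξ)‖ ≤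
      cascade F n j * (potentialConst Φhat β' τ / (Real.exp 1 * δ) * |t|) ^ n / n.factorial
        * Real.exp (-(β' - n * δ) * phaseWeight ξ η) := by
  induction n generalizing t j with
  | zero => simpa [dysonTerm, transport, cascade] using hF j ξ η
  | succ n ih =>
    push_cast at hn
    have hn' : n * δ ≤ β' := by linarith
    have hC0 := potentialConst_nonneg Φhat β' τ
    set C := potentialConst Φhat β' τ
    set D := C / (Real.exp 1 * δ)
    have hD0 : 0 ≤ D := by positivity
    set W := phaseWeight ξ η
    have hcas := cascade_nonneg hF0
    have key : ∀ s, |s| ≤ |t| →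
        ‖transport (t - s) (interaction Φhat ħ N (dysonTerm Φhat ħ N fin n s) j) ξ
          (η + t • ξ)‖ ≤ (cascade F (n + 1) j * D ^ n / n.factorial * C *
            (W * Real.exp (-(β' - n * δ) * W))) * |s| ^ n := by
      intro s hs
      have e : η + t • ξ - (t - s) • ξ = η + s • ξ := by simp only [sub_smul]; abel
      have hsτ := hs.trans ht
      have h1 := norm_interaction_le_exp hC hτ hħ (ρ := β' - n * δ) (by linarith)
        (by nlinarith [(Nat.cast_nonneg n : (0 : ℝ) ≤ n)]) hsτ
        (K := fun j => cascade F n j * (D * |s|) ^ n / n.factorial)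
        (fun j => by have := hcas n j; positivity)
        ((isAdmissible_dysonTerm hΦ hħ N fin n).truncated s)
        (fun j ξ η => by simpa using ih hn' hsτ j ξ (η - s • ξ)) j ξ η
      simp only [transport, e]
      refine h1.trans_eq ?_
      simp only [cascade]
      ring
    have h2 := norm_integral_le_of_norm_le_pow n key
    refine h2.trans ?_
    have h3 := mul_exp_neg_le hδ W (β' - n * δ)
    have e4 : β' - n * δ - δ = β' - (n + 1 : ℕ) * δ := by push_cast; ring
    rw [e4] at h3
    have hc1 := hcas (n + 1) j
    calc _ ≤ (cascade F (n + 1) j * D ^ n / n.factorial * C *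
          (1 / (Real.exp 1 * δ) * Real.exp (-(β' - (n + 1 : ℕ) * δ) * W)))
            * |t| ^ (n + 1) / (n + 1) := by gcongr
      _ = cascade F (n + 1) j * D ^ n / n.factorial * D *
          Real.exp (-(β' - (n + 1 : ℕ) * δ) * W) * |t| ^ (n + 1) / (n + 1) := by
        simp only [D]; ring
      _ = _ := by
        clear_value D
        rw [Nat.factorial_succ, mul_pow]
        push_cast
        field_simp
        ring

/-! ### The norms -/

theorem fourierNorm_le_iff {j : ℕ} {ρ K : ℝ} (hK : 0 ≤ K) {φ : FourierFun d j} :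
    fourierNorm ρ φ ≤ ENNReal.ofReal K ↔
      ∀ ξ η, ‖φ ξ η‖ ≤ K * Real.exp (-ρ * phaseWeight ξ η) := by
  simp only [fourierNorm, iSup_le_iff, ENNReal.ofReal_le_ofReal_iff hK]
  refine forall₂_congr fun ξ η => ?_
  rw [neg_mul, Real.exp_neg, ← div_eq_mul_inv, le_div_iff₀ (Real.exp_pos _)]
  rfl

/-- `‖f^{⊗j}‖_ρ ≤ ‖f‖_ρ^j`, so that the norms of factorized data are finite. -/
theorem fourierNorm_factorizedData_lt_top {N : ℕ} {fin : WignerDistribution d 1} {β' : ℝ}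
    (h : fin.norm β' < ⊤) (j : ℕ) : fourierNorm β' (factorizedData N fin j) < ⊤ := by
  have hm0 : 0 ≤ (fin.norm β').toReal := ENNReal.toReal_nonneg
  have hm : fourierNorm β' fin.ft ≤ ENNReal.ofReal (fin.norm β').toReal :=
    (ENNReal.ofReal_toReal h.ne).ge
  rw [fourierNorm_le_iff hm0] at hm
  set m := (fin.norm β').toReal
  refine lt_of_le_of_lt ((fourierNorm_le_iff (pow_nonneg hm0 j)).2 fun ξ η => ?_)
    ENNReal.ofReal_lt_top
  unfold factorizedData
  split_ifs
  · rw [norm_prod]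
    calc ∏ i, ‖fin.ft (fun _ => ξ i) (fun _ => η i)‖
        ≤ ∏ i, (m * Real.exp (-β' * (‖ξ i‖ + ‖η i‖))) :=
          Finset.prod_le_prod (fun _ _ => norm_nonneg _) fun i _ => by
            simpa [phaseWeight] using hm (fun _ => ξ i) (fun _ => η i)
      _ = _ := by
          rw [Finset.prod_mul_distrib, ← Real.exp_sum, phaseWeight, Finset.mul_sum]
          simp
  · simpa using by positivity

theorem fourierNorm_le_tsum {j : ℕ} {ρ : ℝ} {φ : FourierFun d j} {ψ : ℕ → FourierFun d j}
    (h : ∀ ξ η, HasSum (fun n => ψ n ξ η) (φ ξ η)) :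
    fourierNorm ρ φ ≤ ∑' n, fourierNorm ρ (ψ n) := by
  have e : ∀ (χ : FourierFun d j) ξ η,
      ENNReal.ofReal (‖χ ξ η‖ * Real.exp (ρ * ∑ i, (‖ξ i‖ + ‖η i‖))) =
        ‖χ ξ η‖ₑ * ENNReal.ofReal (Real.exp (ρ * ∑ i, (‖ξ i‖ + ‖η i‖))) := fun χ ξ η => by
    rw [ENNReal.ofReal_mul (norm_nonneg _), ofReal_norm]
  refine iSup₂_le fun ξ η => ?_
  rw [e, ← (h ξ η).tsum_eq]
  calc _ ≤ (∑' n, ‖ψ n ξ η‖ₑ) * ENNReal.ofReal (Real.exp (ρ * ∑ i, (‖ξ i‖ + ‖η i‖))) := by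
        gcongr
        exact enorm_tsum_le_tsum_enorm
    _ = ∑' n, ENNReal.ofReal (‖ψ n ξ η‖ * Real.exp (ρ * ∑ i, (‖ξ i‖ + ‖η i‖))) := by
        rw [← ENNReal.tsum_mul_right]
        exact tsum_congr fun n => (e (ψ n) ξ η).symm
    _ ≤ _ := ENNReal.tsum_le_tsum fun n => le_iSup₂_of_le ξ η le_rfl

theorem fourierSeqNorm_le_tsum {α β : ℝ} {u : ∀ j : ℕ, FourierFun d j}
    {v : ℕ → ∀ j : ℕ, FourierFun d j} (h : ∀ j ξ η, HasSum (fun n => v n j ξ η) (u j ξ η)) :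
    fourierSeqNorm α β u ≤ ∑' n, fourierSeqNorm α β (v n) := by
  unfold fourierSeqNorm
  rw [ENNReal.tsum_comm]
  refine ENNReal.tsum_le_tsum fun k => ?_
  rw [ENNReal.tsum_mul_left]
  gcongr
  exact fourierNorm_le_tsum (h (k + 1))

/-- Summing the combinatorial factors with the weights `e^{-αj}` costs `1 + e^α ≤ 2e^α` per
step. -/
theorem tsum_cascade_le {α : ℝ} (hα : 0 ≤ α) {F : ℕ → ℝ} (hF : ∀ j, 0 ≤ F j) (n : ℕ) :
    ∑' k : ℕ, ENNReal.ofReal (Real.exp (-α * ((k + 1 : ℕ) : ℝ)))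
        * ENNReal.ofReal (cascade F n (k + 1)) ≤
      ENNReal.ofReal ((2 * Real.exp α) ^ n) *
        ∑' k : ℕ, ENNReal.ofReal (Real.exp (-α * ((k + 1 : ℕ) : ℝ)))
          * ENNReal.ofReal (F (k + 1)) := by
  induction n with
  | zero => simp [cascade]
  | succ n ih =>
    set g : ℕ → ℝ≥0∞ := fun k => ENNReal.ofReal (Real.exp (-α * ((k + 1 : ℕ) : ℝ)))
        * ENNReal.ofReal (cascade F n (k + 1))
    have hsplit : ∀ k : ℕ, ENNReal.ofReal (Real.exp (-α * ((k + 1 : ℕ) : ℝ)))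
        * ENNReal.ofReal (cascade F (n + 1) (k + 1)) =
          g k + ENNReal.ofReal (Real.exp α) * g (k + 1) := by
      intro k
      simp only [g, cascade]
      rw [ENNReal.ofReal_add (cascade_nonneg hF _ _) (cascade_nonneg hF _ _), mul_add,
        ← mul_assoc (ENNReal.ofReal (Real.exp α)), ← ENNReal.ofReal_mul (Real.exp_pos α).le,
        ← Real.exp_add]
      congr 4
      push_cast
      ring_nf
    have hshift : ∑' k, g (k + 1) ≤ ∑' k, g k :=
      ENNReal.tsum_comp_le_tsum_of_injective (add_left_injective 1) g
    calc _ = ∑' k, g k + ENNReal.ofReal (Real.exp α) * ∑' k, g (k + 1) := by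
          rw [tsum_congr hsplit, ENNReal.tsum_add, ENNReal.tsum_mul_left]
      _ ≤ ENNReal.ofReal (Real.exp α) * ∑' k, g k + ENNReal.ofReal (Real.exp α) * ∑' k, g k := by
          gcongr
          exact le_mul_of_one_le_left' (ENNReal.one_le_ofReal.2 (Real.one_le_exp hα))
      _ = ENNReal.ofReal (2 * Real.exp α) * ∑' k, g k := by
          rw [ENNReal.ofReal_mul two_pos.le, ENNReal.ofReal_ofNat]; ring
      _ ≤ _ := by
          rw [pow_succ' (2 * Real.exp α), ENNReal.ofReal_mul (by positivity : 0 ≤ 2 * Real.exp α),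
            mul_assoc]
          exact mul_le_mul_right ih _

theorem mul_div_exp_pow_div_factorial_le {x : ℝ} (hx : 0 ≤ x) (n : ℕ) :
    (x * (n / Real.exp 1)) ^ n / n.factorial ≤ x ^ n := by
  have hfac : (n : ℝ) ^ n / n.factorial ≤ Real.exp 1 ^ n := by
    rw [← Real.exp_nat_mul, mul_one]
    exact Real.pow_div_factorial_le_exp _ n.cast_nonneg n
  calc _ = x ^ n * ((n : ℝ) ^ n / n.factorial / Real.exp 1 ^ n) := by
        rw [mul_pow, div_pow]; ring
    _ ≤ x ^ n * 1 := by
        gcongr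
        exact div_le_one_of_le₀ hfac (by positivity)
    _ = _ := mul_one _

/-- The Cauchy–Kovalevskaya estimate. The total loss `β' - β(1+τ)` in the exponential rate is
distributed equally over the `n` factors `T^N + C^N`, and `nⁿ ≤ eⁿ n!` absorbs the resulting
powers of `n`. -/
theorem fourierNorm_dysonTerm_le {Φhat : Space d → ℂ} (hΦ : Integrable Φhat) {β β' τ : ℝ}
    (hC : Integrable (potentialWeight Φhat β' τ)) (hτ : τ ≤ 1) {ħ : ℝ} (hħ : 0 < ħ)
    (hβ : 0 ≤ β) (hββ' : β * (1 + τ) < β')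
    {N : ℕ} {fin : WignerDistribution d 1} {F : ℕ → ℝ} (hF0 : ∀ j, 0 ≤ F j)
    (hF : ∀ j ξ η, ‖factorizedData N fin j ξ η‖ ≤ F j * Real.exp (-β' * phaseWeight ξ η))
    (n : ℕ) {t : ℝ} (ht : |t| ≤ τ) (j : ℕ) :
    fourierNorm β (dysonTerm Φhat ħ N fin n t j) ≤
      ENNReal.ofReal (cascade F n j *
        (potentialConst Φhat β' τ / (β' - β * (1 + τ)) * |t|) ^ n) := by
  have hC0 := potentialConst_nonneg Φhat β' τ
  have hc := cascade_nonneg hF0 n j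
  have hτ0 : 0 ≤ τ := (abs_nonneg t).trans ht
  have hΔ : 0 < β' - β * (1 + τ) := sub_pos.2 hββ'
  have hρ : 0 ≤ β * (1 + τ) := by positivity
  set C := potentialConst Φhat β' τ
  set Δ := β' - β * (1 + τ) with hΔdef
  refine (fourierNorm_le_iff (by positivity)).2 fun ξ η => ?_
  -- Along the free flow the term decays with the rate `β(1 + τ)`.
  have key : ‖dysonTerm Φhat ħ N fin n t j ξ (η - t • ξ + t • ξ)‖ ≤
      cascade F n j * (C / Δ * |t|) ^ n *
        Real.exp (-(β * (1 + τ)) * phaseWeight ξ (η - t • ξ)) := by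
    have hW := phaseWeight_nonneg ξ (η - t • ξ)
    rcases Nat.eq_zero_or_pos n with rfl | hn
    · refine (norm_dysonTerm_le_exp hΦ hC hτ hħ hF0 hF one_pos 0 (by simp; linarith) ht j ξ
        (η - t • ξ)).trans ?_
      simp only [pow_zero, mul_one, Nat.factorial_zero, Nat.cast_one, div_one, Nat.cast_zero,
        sub_zero]
      gcongr
    · have hn0 : (0 : ℝ) < n := by exact_mod_cast hn
      have hnδ : n * (Δ / n) = Δ := by field_simp
      refine (norm_dysonTerm_le_exp hΦ hC hτ hħ hF0 hF (div_pos hΔ hn0) n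
        (by rw [hnδ]; linarith) ht j ξ (η - t • ξ)).trans ?_
      rw [hnδ, show β' - Δ = β * (1 + τ) by rw [hΔdef]; ring]
      have hrate : C / (Real.exp 1 * (Δ / n)) * |t| = C / Δ * |t| * (n / Real.exp 1) := by
        field_simp
      rw [hrate, mul_div_assoc]
      gcongr
      exact mul_div_exp_pow_div_factorial_le (by positivity) n
  rw [sub_add_cancel] at key
  refine key.trans ?_
  have h1 := mul_le_mul_of_nonneg_left (phaseWeight_le_transport t ξ η) hβ
  have h2 : β * ((1 + |t|) * phaseWeight ξ (η - t • ξ)) ≤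
      β * ((1 + τ) * phaseWeight ξ (η - t • ξ)) := by
    have := phaseWeight_nonneg ξ (η - t • ξ)
    gcongr
  exact mul_le_mul_of_nonneg_left (Real.exp_le_exp.2 (by linarith)) (by positivity)

/-- The factor `2(1+τ)` in the relation for `β₀` is more than what the estimate requires. -/
theorem fourierSeqNorm_dysonTerm_le {Φhat : Space d → ℂ} (hΦ : Integrable Φhat) {α β β' β₀ : ℝ}
    (hα : 0 ≤ α) (hβ : 0 < β) (hβ₀ : IsBetaZero Φhat α β β' β₀)
    (hC : Integrable (potentialWeight Φhat β' ((β₀ - β) / β₀))) {ħ : ℝ} (hħ : 0 < ħ)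
    {N : ℕ} {fin : WignerDistribution d 1} (hfin : fin.norm β' < ⊤)
    (n : ℕ) {t : ℝ} (ht : |t| ≤ (β₀ - β) / β₀) :
    fourierSeqNorm α β (dysonTerm Φhat ħ N fin n t) ≤
      ENNReal.ofReal ((|t| / ((β₀ - β) / β₀)) ^ n) *
        fourierSeqNorm α β' (factorizedData N fin) := by
  obtain ⟨h1, h2, h3⟩ := hβ₀
  have hβ₀pos : 0 < β₀ := hβ.trans h1
  set τ := (β₀ - β) / β₀ with hτ
  have hτ0 : 0 < τ := div_pos (sub_pos.2 h1) hβ₀pos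
  have hτ1 : τ ≤ 1 := by rw [hτ, div_le_one hβ₀pos]; linarith
  have hβτ : β = β₀ * (1 - τ) := by rw [hτ]; field_simp; ring
  have hρ : β * (1 + τ) < β₀ := by
    rw [hβτ]; nlinarith [mul_pos hβ₀pos (mul_pos hτ0 hτ0)]
  have hΔ : 0 < β' - β * (1 + τ) := by linarith
  have hC0 := potentialConst_nonneg Φhat β' τ
  set F : ℕ → ℝ := fun j => (fourierNorm β' (factorizedData N fin j)).toReal
  have hFeq : ∀ j, ENNReal.ofReal (F j) = fourierNorm β' (factorizedData N fin j) := fun j =>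
    ENNReal.ofReal_toReal (fourierNorm_factorizedData_lt_top hfin j).ne
  have hF0 : ∀ j, 0 ≤ F j := fun j => ENNReal.toReal_nonneg
  have hF : ∀ j ξ η, ‖factorizedData N fin j ξ η‖ ≤ F j * Real.exp (-β' * phaseWeight ξ η) :=
    fun j => (fourierNorm_le_iff (hF0 j)).1 (hFeq j).ge
  set D := potentialConst Φhat β' τ / (β' - β * (1 + τ)) with hD
  have hD0 : 0 ≤ D := by positivity
  have hrate : D * |t| * (2 * Real.exp α) ≤ |t| / τ := by
    have h4 : τ * potentialConst Φhat β' τ * (2 * Real.exp α) ≤ β' - β * (1 + τ) := by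
      have h5 : 0 ≤ τ * potentialConst Φhat β' τ * (2 * Real.exp α) * τ := by positivity
      linarith
    rw [hD, le_div_iff₀ hτ0]
    calc _ = τ * potentialConst Φhat β' τ * (2 * Real.exp α) / (β' - β * (1 + τ)) * |t| := by ring
      _ ≤ 1 * |t| := by
        gcongr
        exact div_le_one_of_le₀ h4 hΔ.le
      _ = |t| := one_mul _
  calc fourierSeqNorm α β (dysonTerm Φhat ħ N fin n t)
      ≤ ∑' k : ℕ, ENNReal.ofReal (Real.exp (-α * ((k + 1 : ℕ) : ℝ)))
          * (ENNReal.ofReal (cascade F n (k + 1)) * ENNReal.ofReal ((D * |t|) ^ n)) := by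
        refine ENNReal.tsum_le_tsum fun k => ?_
        gcongr
        rw [← ENNReal.ofReal_mul (cascade_nonneg hF0 _ _)]
        exact fourierNorm_dysonTerm_le hΦ hC hτ1 hħ hβ.le (by linarith) hF0 hF n ht (k + 1)
    _ = (∑' k : ℕ, ENNReal.ofReal (Real.exp (-α * ((k + 1 : ℕ) : ℝ)))
          * ENNReal.ofReal (cascade F n (k + 1))) * ENNReal.ofReal ((D * |t|) ^ n) := by
        rw [← ENNReal.tsum_mul_right]
        simp only [mul_assoc]
    _ ≤ (ENNReal.ofReal ((2 * Real.exp α) ^ n) * fourierSeqNorm α β' (factorizedData N fin))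
          * ENNReal.ofReal ((D * |t|) ^ n) := by
        gcongr
        simpa only [fourierSeqNorm, hFeq] using tsum_cascade_le hα hF0 n
    _ = ENNReal.ofReal ((D * |t| * (2 * Real.exp α)) ^ n)
          * fourierSeqNorm α β' (factorizedData N fin) := by
        rw [mul_pow _ (2 * Real.exp α), ENNReal.ofReal_mul (by positivity)]
        ring
    _ ≤ _ := by gcongr

theorem tsum_ofReal_pow_add {x : ℝ} (hx0 : 0 ≤ x) (hx1 : x < 1) (m : ℕ) :
    ∑' n : ℕ, ENNReal.ofReal (x ^ (n + m)) = ENNReal.ofReal (x ^ m / (1 - x)) := by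
  rw [← ENNReal.ofReal_tsum_of_nonneg (fun n => pow_nonneg hx0 _)
    ((summable_nat_add_iff m).2 (summable_geometric_of_lt_one hx0 hx1))]
  simp only [pow_add, tsum_mul_right, tsum_geometric_of_lt_one hx0 hx1]
  rw [inv_mul_eq_div]

/-- The remainder of the Dyson expansion after its first `m` terms. -/
theorem fourierSeqNorm_sub_dyson_le {Φhat : Space d → ℂ} (hΦ : Integrable Φhat) {α β β' β₀ : ℝ}
    (hα : 0 ≤ α) (hβ : 0 < β) (hβ₀ : IsBetaZero Φhat α β β' β₀)
    (hC : Integrable (potentialWeight Φhat β' ((β₀ - β) / β₀))) {ħ : ℝ} (hħ : 0 < ħ)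
    {N : ℕ} {fin : WignerDistribution d 1} (hfin : fin.norm β' < ⊤)
    {f : ℝ → ∀ j : ℕ, WignerDistribution d j} (hf : IsSolution Φhat ħ N fin f)
    (m : ℕ) {t : ℝ} (ht : |t| < (β₀ - β) / β₀) :
    fourierSeqNorm α β (fun j ξ η => (f t j).ft ξ η -
        ∑ n ∈ Finset.range m, dysonTerm Φhat ħ N fin n t j ξ η) ≤
      ENNReal.ofReal ((|t| / ((β₀ - β) / β₀)) ^ m / (1 - |t| / ((β₀ - β) / β₀))) *
        fourierSeqNorm α β' (factorizedData N fin) := by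
  have hτ0 : 0 < (β₀ - β) / β₀ := (abs_nonneg t).trans_lt ht
  calc _ ≤ ∑' n, fourierSeqNorm α β (dysonTerm Φhat ħ N fin (n + m) t) :=
        fourierSeqNorm_le_tsum fun j ξ η => (hasSum_nat_add_iff' m).2
          ((hf.isMildSolution hΦ hħ).hasSum_dysonTerm hΦ hħ t j ξ η)
    _ ≤ ∑' n : ℕ, ENNReal.ofReal ((|t| / ((β₀ - β) / β₀)) ^ (n + m)) *
          fourierSeqNorm α β' (factorizedData N fin) :=
        ENNReal.tsum_le_tsum fun n =>
          fourierSeqNorm_dysonTerm_le hΦ hα hβ hβ₀ hC hħ hfin (n + m) ht.le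
    _ = _ := by
        rw [ENNReal.tsum_mul_right, tsum_ofReal_pow_add (by positivity) ((div_lt_one hτ0).2 ht)]

/-! ### The exponent `β₀` -/

theorem potentialWeight_nonneg (Φhat : Space d → ℂ) (β t : ℝ) (h : Space d) :
    0 ≤ potentialWeight Φhat β t h := by
  unfold potentialWeight; positivity

theorem potentialWeight_mono (Φhat : Space d → ℂ) {β s t : ℝ} (hβ : 0 ≤ β) (hst : |s| ≤ |t|)
    (h : Space d) : potentialWeight Φhat β s h ≤ potentialWeight Φhat β t h := by
  unfold potentialWeight; gcongr

theorem integrable_potentialWeight {Φhat : Space d → ℂ} (hΦ : Integrable Φhat) {β s t : ℝ}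
    (hβ : 0 ≤ β) (hst : |s| ≤ |t|) (hC : Integrable (potentialWeight Φhat β t)) :
    Integrable (potentialWeight Φhat β s) := by
  refine hC.mono' ?_ (.of_forall fun h => ?_)
  · have h1 : Continuous fun h : Space d => Real.exp (2 * β * ‖h‖ * (1 + |s|)) := by fun_prop
    exact (continuous_norm.aestronglyMeasurable.mul hΦ.aestronglyMeasurable.norm).mul
      h1.aestronglyMeasurable
  · rw [Real.norm_of_nonneg (potentialWeight_nonneg _ _ _ _)]
    exact potentialWeight_mono Φhat hβ hst h

theorem potentialConst_mono {Φhat : Space d → ℂ} (hΦ : Integrable Φhat) {β s t : ℝ}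
    (hβ : 0 ≤ β) (hst : |s| ≤ |t|) (hC : Integrable (potentialWeight Φhat β t)) :
    potentialConst Φhat β s ≤ potentialConst Φhat β t :=
  integral_mono (integrable_potentialWeight hΦ hβ hst hC) hC fun h =>
    potentialWeight_mono Φhat hβ hst h

theorem continuousOn_potentialConst {Φhat : Space d → ℂ} (hΦ : Integrable Φhat) {β t : ℝ}
    (hβ : 0 ≤ β) (hC : Integrable (potentialWeight Φhat β t)) :
    ContinuousOn (potentialConst Φhat β) {s | |s| ≤ |t|} := by
  refine continuousOn_of_dominated (bound := potentialWeight Φhat β t) (fun s hs => ?_)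
    (fun s hs => .of_forall fun h => ?_) hC (.of_forall fun h => ?_)
  · exact (integrable_potentialWeight hΦ hβ hs hC).aestronglyMeasurable
  · rw [Real.norm_of_nonneg (potentialWeight_nonneg _ _ _ _)]
    exact potentialWeight_mono Φhat hβ hs h
  · unfold potentialWeight
    fun_prop

/-- The left-hand side of the relation for `β₀` is nondecreasing in `β₀` and vanishes at `β`,
whereas the right-hand side decreases strictly from `β' - β > 0` to `0`. -/
theorem existsUnique_isBetaZero {Φhat : Space d → ℂ} (hΦ : Integrable Φhat) {α β β' : ℝ}
    (hβ : 0 < β) (hββ' : β < β') (hC : Integrable (potentialWeight Φhat β' ((β' - β) / β'))) :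
    ∃! β₀, IsBetaZero Φhat α β β' β₀ := by
  have hβ' : 0 < β' := hβ.trans hββ'
  let τ : ℝ → ℝ := fun b => (b - β) / b
  let G : ℝ → ℝ := fun b => 2 * (1 + τ b) * τ b * potentialConst Φhat β' (τ b) * Real.exp α
  have hτmono : ∀ {b c : ℝ}, β ≤ b → b ≤ c → τ b ≤ τ c := by
    intro b c hb hbc
    have hb0 : 0 < b := hβ.trans_le hb
    simp only [τ]
    rw [div_le_div_iff₀ hb0 (hb0.trans_le hbc)]
    nlinarith
  have hτ0 : ∀ {b : ℝ}, β ≤ b → 0 ≤ τ b := fun hb =>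
    div_nonneg (sub_nonneg.2 hb) (hβ.le.trans hb)
  have habs : ∀ {b c : ℝ}, β ≤ b → b ≤ c → |τ b| ≤ |τ c| := by
    intro b c hb hbc
    rw [abs_of_nonneg (hτ0 hb), abs_of_nonneg (hτ0 (hb.trans hbc))]
    exact hτmono hb hbc
  have hGmono : ∀ {b c : ℝ}, β ≤ b → b ≤ c → c ≤ β' → G b ≤ G c := by
    intro b c hb hbc hc
    have h1 := hτ0 hb
    have h2 := hτmono hb hbc
    have h3 := potentialConst_mono hΦ hβ'.le (habs hb hbc)
      (integrable_potentialWeight hΦ hβ'.le (habs (hb.trans hbc) hc) hC)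
    have h4 := potentialConst_nonneg Φhat β' (τ b)
    have h5 := h1.trans h2
    simp only [G]
    gcongr
  have hτcont : ContinuousOn τ (Set.Icc β β') :=
    ContinuousOn.div (by fun_prop) continuousOn_id fun b hb => (hβ.trans_le hb.1).ne'
  have hGcont : ContinuousOn G (Set.Icc β β') := by
    have h1 : ContinuousOn (fun b => potentialConst Φhat β' (τ b)) (Set.Icc β β') :=
      (continuousOn_potentialConst hΦ hβ'.le hC).comp hτcont fun b hb => habs hb.1 hb.2
    exact .mul (.mul (.mul (by fun_prop) hτcont) h1) continuousOn_const
  have hG0 : G β = 0 := by simp [G, τ]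
  have hG1 : 0 ≤ G β' := hG0 ▸ hGmono le_rfl hββ'.le le_rfl
  obtain ⟨b, hb, hbG⟩ : (0 : ℝ) ∈ (fun b => G b - (β' - b)) '' Set.Icc β β' :=
    intermediate_value_Icc hββ'.le (hGcont.sub (by fun_prop))
      ⟨by change G β - (β' - β) ≤ 0; rw [hG0]; linarith, by simpa using hG1⟩
  have hne : b ≠ β := by
    rintro rfl
    simp only [hG0] at hbG
    linarith
  refine ⟨b, ⟨lt_of_le_of_ne hb.1 hne.symm, hb.2, sub_eq_zero.1 hbG⟩, ?_⟩
  rintro c ⟨hc1, hc2, hc3⟩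
  change G c = β' - c at hc3
  have hb3 : G b = β' - b := sub_eq_zero.1 hbG
  rcases le_total b c with h | h
  · linarith [hGmono hb.1 h hc2]
  · linarith [hGmono hc1.le h hb.2]

end WignerHierarchy

theorem mainTheorem5 (d : ℕ) (Φ : WignerHierarchy.Space d → ℝ) (Φhat : WignerHierarchy.Space d → ℂ)
    (hΦ_even : ∀ x, Φ (-x) = Φ x)
    (hΦ : WignerHierarchy.IsFourierTransform Φ Φhat)
    (α β β' : ℝ) (hα : 0 < α) (hβ : 0 < β) (hββ' : β < β')
    (hC : Integrable (WignerHierarchy.potentialWeight Φhat β' ((β' - β) / β'))) :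
    ∃ β₀ : ℝ,
      WignerHierarchy.IsBetaZero Φhat α β β' β₀ ∧
      (∀ b, WignerHierarchy.IsBetaZero Φhat α β β' b → b = β₀) ∧
      ∃ T : ℝ, T = (β₀ - β) / β₀ ∧ 0 < T ∧
        ∀ (ħ : ℝ) (N : ℕ) (fin : WignerHierarchy.WignerDistribution d 1),
          0 < ħ → 1 ≤ N →
          fin.norm β' < ⊤ →
          ENNReal.log (fin.norm β) < (α : EReal) →
          (∃! f : ℝ → ∀ j : ℕ, WignerHierarchy.WignerDistribution d j,
            WignerHierarchy.IsSolution Φhat ħ N fin f) ∧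
          ∀ f : ℝ → ∀ j : ℕ, WignerHierarchy.WignerDistribution d j,
            WignerHierarchy.IsSolution Φhat ħ N fin f →
            ∀ t : ℝ, |t| < T →
              WignerHierarchy.seqNorm α β (f t) ≤
                WignerHierarchy.fourierSeqNorm α β' (WignerHierarchy.factorizedData N fin)
                  / ENNReal.ofReal (1 - |t| / T) ∧
              ∀ K : ℕ,
                WignerHierarchy.fourierSeqNorm α β
                    (fun j ξ η =>
                      (f t j).ft ξ η - WignerHierarchy.dysonSum Φhat ħ N fin K t j ξ η) ≤
                  ENNReal.ofReal ((|t| / T) ^ (K + 1) / (1 - |t| / T))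
                    * WignerHierarchy.fourierSeqNorm α β'
                        (WignerHierarchy.factorizedData N fin) := by
  obtain ⟨β₀, hβ₀, huniq⟩ :=
    WignerHierarchy.existsUnique_isBetaZero (α := α) hΦ.1 hβ hββ' hC
  have hβ₀pos : 0 < β₀ := hβ.trans hβ₀.1
  have hT : 0 < (β₀ - β) / β₀ := div_pos (sub_pos.2 hβ₀.1) hβ₀pos
  have hC₀ : Integrable (WignerHierarchy.potentialWeight Φhat β' ((β₀ - β) / β₀)) := by
    have hβ' : 0 < β' := hβ.trans hββ'
    refine WignerHierarchy.integrable_potentialWeight hΦ.1 hβ'.le ?_ hC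
    rw [abs_of_pos hT, abs_of_pos (div_pos (sub_pos.2 hββ') hβ'), div_le_div_iff₀ hβ₀pos hβ']
    nlinarith [hβ₀.2.1]
  refine ⟨β₀, hβ₀, huniq, _, rfl, hT, fun ħ N fin hħ hN hfin _ =>
    ⟨WignerHierarchy.existsUnique_isSolution hΦ.1 hħ N fin, fun f hf t ht => ⟨?_, fun K => ?_⟩⟩⟩
  · have h := WignerHierarchy.fourierSeqNorm_sub_dyson_le hΦ.1 hα.le hβ hβ₀ hC₀ hħ hfin hf 0 ht
    have hpos : 0 < 1 - |t| / ((β₀ - β) / β₀) := sub_pos.2 ((div_lt_one hT).2 ht)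
    rw [pow_zero, one_div, ENNReal.ofReal_inv_of_pos hpos, mul_comm, ← div_eq_mul_inv] at h
    simp only [Finset.range_zero, Finset.sum_empty, sub_zero] at h
    exact h
  · exact WignerHierarchy.fourierSeqNorm_sub_dyson_le hΦ.1 hα.le hβ hβ₀ hC₀ hħ hfin hf (K + 1) ht
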